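/- **Setting.** Let $A$ be a finite alphabet with $N\ge 2$ letters and $F_N$ the free group on $A$, identified with the set of reduced words over $A\cup A^{-1}$; $\epsilon$ is the empty word, $|u|$ the length of $u$, and $u*v$ denotes a product without cancellation. A word is pure positive if it is non-empty and all its letters are in $A$. Let $\partial F_N$ be the set of infinite reduced words, with the product topology and the action of $F_N$ by left translation, and $\partial^2F_N=(\partial F_N\times\partial F_N)\setminus\Delta$, where $\Delta$ is the diagonal. An automorphism $\psi$ of $F_N$ induces homeomorphisms $\partial\psi$ of $\partial F_N$ and $\partial^2\psi$ of $\partial^2F_N$. Let $i_w(u)=w^{-1}uw$. The shift is $S(X,Y)=(Y_0^{-1}X,Y_0^{-1}Y)$, where $Y_0$ is the first letter of $Y$; on pairs whose coordinates have different first letters it is invertible, with $S^{-1}(X,Y)=(X_0^{-1}X,X_0^{-1}Y)$. Let $\varphi$ be an automorphism of $F_N$ that is $A$-positive ($\varphi(a)$ is pure positive for every $a\in A$) and primitive (for some $k\ge1$, every letter of $A$ occurs in $\varphi^k(a)$ for every $a\in A$). Choose $a\in A$, $k\ge 1$ and pure positive $p,s$ with $\varphi^k(a)=p*a*s$, and put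 $X=\lim_n p^{-1}\varphi^k(p^{-1})\cdots\varphi^{nk}(p^{-1})$ and $Y=\lim_n as\varphi^k(s)\cdots\varphi^{nk}(s)$. The attracting subshift $\Sigma_\varphi$ is the closure in $\partial^2F_N$ of $\{S^n(X,Y):n\in\mathbb Z\}$; it does not depend on the choices. The prefix-suffix development $\rho_\varphi(W)=(p_i,a_i,s_i)_{i\ge0}$ of $W\in\Sigma_\varphi$ is the sequence in $F_N\times A\times F_N$ for which there are $W_i=(U_i,V_i)\in\Sigma_\varphi$ with $W_0=W$ such that, for all $i\ge 0$, $V_i$ begins with $a_i$, $\varphi(a_{i+1})=p_i*a_i*s_i$ and $W_i=S^{|p_i|}(\partial^2\varphi(W_{i+1}))$. We write $\rho_\varphi(W)=(p,a,s)*$ if it is constant equal to $(p,a,s)$. A singularity is a set $\Omega\subseteq\Sigma_\varphi$ with at least two elements for which there is an automorphism $\psi=i_w\circ\varphi^k$ ($w\in F_N$, $k\ge1$) such that every point of $\Omega$ is fixed by $\partial^2\psi$, every point of $\Sigma_\varphi$ fixed by $\partial^2\psi^h$ for some $h\ge1$ is in $\Omega$, and there are $(U,V),(U',V')\in\Omega$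 with $U_0\neq U'_0$ or $V_0\neq V'_0$. We say that such a $\psi$ fixes $\Omega$. For $u=u_0\cdots u_m\in F_N$ let $\gamma_-(u)=\varphi(u_m)u_0\cdots u_{m-1}$ and $\gamma_+(u)=u_1\cdots u_m\varphi(u_0)$, and let $\gamma_\pm(\epsilon)=\epsilon$. **Theorem.** Let $W\ne W'$ be points of $\Sigma_\varphi$ with $\rho_\varphi(W)=(p,a,s)*$ and $\rho_\varphi(W')=(q,b,r)*$. (1) If $\gamma_-^i(p)\neq\gamma_-^j(q)$ for all $i,j\ge0$, then for all $i,j\ge0$, with $i=0$ if $p=\epsilon$ and $j=0$ if $q=\epsilon$, the points $S^{-i}(W)$ and $S^{-j}(W')$ do not belong to a common singularity. If $\gamma_+^i(s)\neq\gamma_+^j(r)$ for all $i,j\ge0$, then for all $i,j\ge0$, with $i=0$ if $s=\epsilon$ and $j=0$ if $r=\epsilon$, the points $S^{i+1}(W)$ and $S^{j+1}(W')$ do not belong to a common singularity. (2) Suppose that $(p,a,s)\neq(q,b,r)$ or $p=\epsilon$. If $i$ and $j$ are the smallest integers with $\gamma_-^i(p)=\gamma_-^j(q)$ (that is, equality holds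 for $(i,j)$, and $i\le i'$, $j\le j'$ for every other pair $(i',j')$ for which it holds), then $S^{-i}(W)$ and $S^{-j}(W')$ belong to a common singularity $\Omega$, and $\Omega$ is fixed by $(i_w\circ\varphi)^h$ for some $h\ge1$, where $w=\gamma_-^i(p)$. Suppose that $(p,a,s)\neq(q,b,r)$ or $s=\epsilon$. If $i$ and $j$ are, in the same sense, the smallest integers with $\gamma_+^i(s)=\gamma_+^j(r)$, then $S^{i+1}(W)$ and $S^{j+1}(W')$ belong to a common singularity $\Omega$, and $\Omega$ is fixed by $(i_w\circ\varphi)^h$ for some $h\ge1$, where $w^{-1}=\gamma_+^i(s)$. -/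

import Mathlib

open Filter

/-! ### The boundary of the free group

A letter of `A ∪ A⁻¹` is a pair `(a, b) : A × Bool`, as in `FreeGroup`: `(a, true)` stands for `a`
and `(a, false)` for `a⁻¹`.  Elements of `FreeGroup A` are identified with reduced words through
`FreeGroup.toWord`. -/

/-- The inverse letter. -/
def letterInv {A : Type*} (x : A × Bool) : A × Bool := (x.1, !x.2)

theorem letterInv_letterInv {A : Type*} (x : A × Bool) : letterInv (letterInv x) = x := by
  simp [letterInv]

/-- The boundary `∂F` of the free group on `A`: infinite reduced words. -/
@[ext]
structure Boundary (A : Type*) where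
  /-- the `i`-th letter -/
  letter : ℕ → A × Bool
  /-- no letter is followed by its inverse -/
  reduced : ∀ i, letter (i + 1) ≠ letterInv (letter i)

/-- The topology of `∂F`: induced by the product topology, the set of letters being discrete. -/
instance {A : Type*} : TopologicalSpace (Boundary A) :=
  TopologicalSpace.induced Boundary.letter
    (@Pi.topologicalSpace ℕ (fun _ => A × Bool) (fun _ => ⊥))

namespace Boundary

/-- Deletion of the first letter. -/
def tail {A : Type*} (X : Boundary A) : Boundary A where
  letter i := X.letter (i + 1)
  reduced i := X.reduced (i + 1)

/-- Insertion of a first letter `x` which does not cancel with the first letter of `X`. -/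
def cons {A : Type*} (x : A × Bool) (X : Boundary A) (h : X.letter 0 ≠ letterInv x) :
    Boundary A where
  letter i := Nat.casesOn i x X.letter
  reduced i := by
    cases i with
    | zero => exact h
    | succ i => exact X.reduced i

/-- Left multiplication by one letter `x`: the letter is added in front, unless it cancels with the
first letter. -/
def letterMul {A : Type*} [DecidableEq A] (x : A × Bool) (X : Boundary A) : Boundary A :=
  if h : X.letter 0 = letterInv x then X.tail else X.cons x h

theorem letterMul_letterMul {A : Type*} [DecidableEq A] (x : A × Bool) (X : Boundary A) :
    letterMul (letterInv x) (letterMul x X) = X := by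
  by_cases h : X.letter 0 = letterInv x
  · have h1 : X.tail.letter 0 ≠ letterInv (letterInv x) := by
      rw [← h]; exact X.reduced 0
    have h2 : letterMul x X = X.tail := by simp [letterMul, h]
    rw [h2, letterMul, dif_neg h1]
    ext1
    funext i
    cases i with
    | zero => exact h.symm
    | succ i => rfl
  · have h2 : letterMul x X = X.cons x h := by simp [letterMul, h]
    have h1 : (X.cons x h).letter 0 = letterInv (letterInv x) := (letterInv_letterInv x).symm
    rw [h2, letterMul, dif_pos h1]
    rfl

/-- Left multiplication by the generator `a`, as a permutation of `∂F`. -/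
def generatorPerm {A : Type*} [DecidableEq A] (a : A) : Equiv.Perm (Boundary A) where
  toFun := letterMul (a, true)
  invFun := letterMul (a, false)
  left_inv X := letterMul_letterMul (a, true) X
  right_inv X := letterMul_letterMul (a, false) X

/-- The action of `F` on `∂F` by left translation. -/
instance {A : Type*} [DecidableEq A] : MulAction (FreeGroup A) (Boundary A) :=
  MulAction.compHom (Boundary A) (FreeGroup.lift (generatorPerm (A := A)))

theorem mk_singleton_smul {A : Type*} [DecidableEq A] (x : A × Bool) (X : Boundary A) :
    (FreeGroup.mk [x]) • X = letterMul x X := by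
  obtain ⟨a, b⟩ := x
  change (FreeGroup.lift (generatorPerm (A := A)) (FreeGroup.mk [(a, b)])) X = _
  rw [FreeGroup.lift_mk]
  cases b
  · simp only [List.map_cons, List.map_nil, List.prod_cons, List.prod_nil, mul_one, cond_false]
    rfl
  · simp only [List.map_cons, List.map_nil, List.prod_cons, List.prod_nil, mul_one, cond_true]
    rfl

/-- The element `X₀ X₁ ⋯ Xₙ₋₁` of the free group. -/
def initialWord {A : Type*} (X : Boundary A) (n : ℕ) : FreeGroup A :=
  FreeGroup.mk ((List.range n).map X.letter)

end Boundary

/-- The sequence `u` of elements of the free group converges to the boundary point `X`: for every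
`m`, the reduced word `u n` begins with `X₀ ⋯ Xₘ₋₁` for all large `n`. -/
def ConvergesTo {A : Type*} [DecidableEq A] (u : ℕ → FreeGroup A) (X : Boundary A) : Prop :=
  ∀ m : ℕ, ∀ᶠ n in atTop, ∀ i < m, (u n).toWord[i]? = some (X.letter i)

/-- `∂ψ (X) = Y`, where `∂ψ` is the homeomorphism of `∂F` induced by the automorphism `ψ`, that is,
its continuous extension to the boundary: `Y` is the limit of `ψ (X₀ ⋯ Xₙ₋₁)`. -/
def BoundaryMapsTo {A : Type*} [DecidableEq A] (ψ : MulAut (FreeGroup A)) (X Y : Boundary A) :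
    Prop :=
  ConvergesTo (fun n => ψ (X.initialWord n)) Y

/-- The double boundary `∂²F = (∂F × ∂F) \ Δ`, with the subspace topology. -/
abbrev DoubleBoundary (A : Type*) := {Z : Boundary A × Boundary A // Z.1 ≠ Z.2}

/-- `∂²ψ (Z) = Z'`. -/
def DoubleMapsTo {A : Type*} [DecidableEq A] (ψ : MulAut (FreeGroup A))
    (Z Z' : DoubleBoundary A) : Prop :=
  BoundaryMapsTo ψ Z.1.1 Z'.1.1 ∧ BoundaryMapsTo ψ Z.1.2 Z'.1.2

/-- `v (X, Y) = (v X, v Y)`. -/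
def translatePoint {A : Type*} [DecidableEq A] (v : FreeGroup A) (Z : DoubleBoundary A) :
    DoubleBoundary A :=
  ⟨(v • Z.1.1, v • Z.1.2), fun h => Z.2 (MulAction.injective v h)⟩

/-! ### The shift -/

/-- The shift `S (X, Y) = (Y₀⁻¹ X, Y₀⁻¹ Y)`. -/
def shift {A : Type*} [DecidableEq A] (Z : DoubleBoundary A) : DoubleBoundary A :=
  translatePoint (FreeGroup.mk [Z.1.2.letter 0])⁻¹ Z

/-- The inverse shift `(X, Y) ↦ (X₀⁻¹ X, X₀⁻¹ Y)`; it is the inverse of `S` on the pairs with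
`X₀ ≠ Y₀`, in particular on the pairs with `X` in negative and `Y` in positive letters. -/
def shiftInv {A : Type*} [DecidableEq A] (Z : DoubleBoundary A) : DoubleBoundary A :=
  translatePoint (FreeGroup.mk [Z.1.1.letter 0])⁻¹ Z

theorem letterMul_inv_zero {A : Type*} [DecidableEq A] (x : A × Bool) (X : Boundary A)
    (h : X.letter 0 ≠ x) : (Boundary.letterMul (letterInv x) X).letter 0 = letterInv x := by
  have h1 : X.letter 0 ≠ letterInv (letterInv x) := by rwa [letterInv_letterInv]
  rw [Boundary.letterMul, dif_neg h1]
  rfl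

theorem mk_inv_smul {A : Type*} [DecidableEq A] (x : A × Bool) (X : Boundary A) :
    (FreeGroup.mk [x])⁻¹ • X = Boundary.letterMul (letterInv x) X := by
  rw [← Boundary.mk_singleton_smul]
  rfl

theorem shiftInv_shift {A : Type*} [DecidableEq A] (Z : DoubleBoundary A)
    (h : Z.1.1.letter 0 ≠ Z.1.2.letter 0) : shiftInv (shift Z) = Z := by
  have h1 : (shift Z).1.1.letter 0 = letterInv (Z.1.2.letter 0) := by
    change ((FreeGroup.mk [Z.1.2.letter 0])⁻¹ • Z.1.1).letter 0 = _
    rw [mk_inv_smul, letterMul_inv_zero _ _ h]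
  have h2 : (FreeGroup.mk [letterInv (Z.1.2.letter 0)])⁻¹ = FreeGroup.mk [Z.1.2.letter 0] := by
    simp [letterInv, FreeGroup.inv_mk, FreeGroup.invRev]
  apply Subtype.ext
  change ((FreeGroup.mk [(shift Z).1.1.letter 0])⁻¹ • (shift Z).1.1,
    (FreeGroup.mk [(shift Z).1.1.letter 0])⁻¹ • (shift Z).1.2) = Z.1
  rw [h1, h2]
  change (FreeGroup.mk [Z.1.2.letter 0] • (FreeGroup.mk [Z.1.2.letter 0])⁻¹ • Z.1.1,
    FreeGroup.mk [Z.1.2.letter 0] • (FreeGroup.mk [Z.1.2.letter 0])⁻¹ • Z.1.2) = Z.1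
  rw [smul_inv_smul, smul_inv_smul]

theorem shift_shiftInv {A : Type*} [DecidableEq A] (Z : DoubleBoundary A)
    (h : Z.1.1.letter 0 ≠ Z.1.2.letter 0) : shift (shiftInv Z) = Z := by
  have h1 : (shiftInv Z).1.2.letter 0 = letterInv (Z.1.1.letter 0) := by
    change ((FreeGroup.mk [Z.1.1.letter 0])⁻¹ • Z.1.2).letter 0 = _
    rw [mk_inv_smul, letterMul_inv_zero _ _ h.symm]
  have h2 : (FreeGroup.mk [letterInv (Z.1.1.letter 0)])⁻¹ = FreeGroup.mk [Z.1.1.letter 0] := by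
    simp [letterInv, FreeGroup.inv_mk, FreeGroup.invRev]
  apply Subtype.ext
  change ((FreeGroup.mk [(shiftInv Z).1.2.letter 0])⁻¹ • (shiftInv Z).1.1,
    (FreeGroup.mk [(shiftInv Z).1.2.letter 0])⁻¹ • (shiftInv Z).1.2) = Z.1
  rw [h1, h2]
  change (FreeGroup.mk [Z.1.1.letter 0] • (FreeGroup.mk [Z.1.1.letter 0])⁻¹ • Z.1.1,
    FreeGroup.mk [Z.1.1.letter 0] • (FreeGroup.mk [Z.1.1.letter 0])⁻¹ • Z.1.2) = Z.1
  rw [smul_inv_smul, smul_inv_smul]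

/-- The powers `Sⁿ`, `n ∈ ℤ`, of the shift. -/
def shiftPow {A : Type*} [DecidableEq A] : ℤ → DoubleBoundary A → DoubleBoundary A
  | Int.ofNat n => shift^[n]
  | Int.negSucc n => shiftInv^[n + 1]

/-! ### Positive primitive automorphisms and the attracting subshift -/

/-- Pure positive words: non-empty, with all letters in `A`. -/
def PurePositive {A : Type*} [DecidableEq A] (u : FreeGroup A) : Prop :=
  u ≠ 1 ∧ ∀ x ∈ u.toWord, x.2 = true

/-- `φ` is `A`-positive: the image of every letter of `A` is pure positive. -/
def IsPositiveAut {A : Type*} [DecidableEq A] (φ : MulAut (FreeGroup A)) : Prop :=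
  ∀ a : A, PurePositive (φ (FreeGroup.of a))

/-- Primitivity: for some `k ≥ 1`, all letters of `A` occur in `φᵏ(a)`, for every letter `a`. -/
def IsPrimitiveAut {A : Type*} [DecidableEq A] (φ : MulAut (FreeGroup A)) : Prop :=
  ∃ k : ℕ, 1 ≤ k ∧ ∀ a b : A, (b, true) ∈ ((φ ^ k) (FreeGroup.of a)).toWord

/-- The points `(X, Y)` obtained from a letter `a`, a positive power `k` and pure positive `p, s`
with `φᵏ(a) = p a s`:
`X = lim p⁻¹ φᵏ(p⁻¹) ⋯ φⁿᵏ(p⁻¹)` and `Y = lim a s φᵏ(s) ⋯ φⁿᵏ(s)`. -/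
def IsSeed {A : Type*} [DecidableEq A] (φ : MulAut (FreeGroup A)) (Z : DoubleBoundary A) : Prop :=
  ∃ (a : A) (k : ℕ) (p s : FreeGroup A), 1 ≤ k ∧ PurePositive p ∧ PurePositive s ∧
    (φ ^ k) (FreeGroup.of a) = p * FreeGroup.of a * s ∧
    ConvergesTo (fun n => ((List.range (n + 1)).map fun m => (φ ^ (m * k)) p⁻¹).prod) Z.1.1 ∧
    ConvergesTo
      (fun n => FreeGroup.of a * ((List.range (n + 1)).map fun m => (φ ^ (m * k)) s).prod) Z.1.2

/-- The attracting subshift `Σ_φ`: the closure in `∂²F` of the `S`-orbit of a seed.  For a positive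
primitive `φ` this closure is the same for all seeds, so that the union over all seeds is the
closure of the orbit of any one of them. -/
def attractingSubshift {A : Type*} [DecidableEq A] (φ : MulAut (FreeGroup A)) :
    Set (DoubleBoundary A) :=
  {W | ∃ Z, IsSeed φ Z ∧ W ∈ closure (Set.range fun n : ℤ => shiftPow n Z)}

/-! ### Prefix-suffix developments -/

/-- `φ(b) = p * a * s` without cancellation, for letters `a`, `b` of `A`: the edges, from `a` to
`b`, of the prefix-suffix automaton. -/
def IsEdge {A : Type*} [DecidableEq A] (φ : MulAut (FreeGroup A)) (l : FreeGroup A × A × FreeGroup A)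
    (b : A) : Prop :=
  (φ (FreeGroup.of b)).toWord = l.1.toWord ++ (l.2.1, true) :: l.2.2.toWord

/-- `ρ_φ(W) = d`: the sequence `d = (pᵢ, aᵢ, sᵢ)` is the prefix-suffix development of `W ∈ Σ_φ`, that
is, the label sequence obtained by desubstituting `W` indefinitely.  There are points `Wᵢ = (Uᵢ, Vᵢ)`
of `Σ_φ` with `W₀ = W` such that `Vᵢ` begins with `aᵢ`, `φ(aᵢ₊₁) = pᵢ * aᵢ * sᵢ` and
`Wᵢ = S^{|pᵢ|} (∂²φ (Wᵢ₊₁))`. -/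
def IsDevelopment {A : Type*} [DecidableEq A] (φ : MulAut (FreeGroup A)) (W : DoubleBoundary A)
    (d : ℕ → FreeGroup A × A × FreeGroup A) : Prop :=
  ∃ w : ℕ → DoubleBoundary A, w 0 = W ∧
    ∀ i, w i ∈ attractingSubshift φ ∧
      (w i).1.2.letter 0 = ((d i).2.1, true) ∧
      IsEdge φ (d i) (d (i + 1)).2.1 ∧
      ∃ Z, DoubleMapsTo φ (w (i + 1)) Z ∧ w i = shift^[(d i).1.toWord.length] Z

/-! ### Singularities -/

/-- The inner automorphism `i_w : u ↦ w⁻¹ u w`. -/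
def innerAut {A : Type*} (w : FreeGroup A) : MulAut (FreeGroup A) := MulAut.conj w⁻¹

/-- `Ω` is a singularity of `φ` and the automorphism `ψ = i_w ∘ φᵏ` (`k ≥ 1`) fixes it: `Ω` is a set
of at least two points of `Σ_φ`, all fixed by `∂²ψ`, it contains all the points of `Σ_φ` fixed by some
`∂²ψʰ` with `h ≥ 1`, and two of its points differ in the first letter of one of their
coordinates. -/
def FixesSingularity {A : Type*} [DecidableEq A] (φ ψ : MulAut (FreeGroup A))
    (Ω : Set (DoubleBoundary A)) : Prop :=
  (∃ (w : FreeGroup A) (k : ℕ), 1 ≤ k ∧ ψ = innerAut w * φ ^ k) ∧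
  Ω ⊆ attractingSubshift φ ∧
  Ω.Nontrivial ∧
  (∀ Z ∈ Ω, DoubleMapsTo ψ Z Z) ∧
  (∀ h : ℕ, 1 ≤ h → ∀ Z ∈ attractingSubshift φ, DoubleMapsTo (ψ ^ h) Z Z → Z ∈ Ω) ∧
  (∃ Z ∈ Ω, ∃ Z' ∈ Ω,
    Z.1.2.letter 0 ≠ Z'.1.2.letter 0 ∨ Z.1.1.letter 0 ≠ Z'.1.1.letter 0)

/-- `Ω` is a singularity of `φ`. -/
def IsSingularity {A : Type*} [DecidableEq A] (φ : MulAut (FreeGroup A))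
    (Ω : Set (DoubleBoundary A)) : Prop :=
  ∃ ψ, FixesSingularity φ ψ Ω

/-! ### The maps `γ₋` and `γ₊` -/

/-- `γ₋ (u₀ ⋯ uₘ) = φ(uₘ) u₀ ⋯ uₘ₋₁`, and `γ₋ (ε) = ε`. -/
def gammaMinus {A : Type*} [DecidableEq A] (φ : MulAut (FreeGroup A)) (u : FreeGroup A) :
    FreeGroup A :=
  φ (FreeGroup.mk u.toWord.getLast?.toList) * FreeGroup.mk u.toWord.dropLast

/-- `γ₊ (u₀ ⋯ uₘ) = u₁ ⋯ uₘ φ(u₀)`, and `γ₊ (ε) = ε`. -/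
def gammaPlus {A : Type*} [DecidableEq A] (φ : MulAut (FreeGroup A)) (u : FreeGroup A) :
    FreeGroup A :=
  FreeGroup.mk u.toWord.tail * φ (FreeGroup.mk u.toWord.head?.toList)

/-! ### Multiplication by a letter and reduced words -/

section Words

/-! Since φ(a) = p * a * s, the relation W_i = S^{|p|}(∂²φ(W_{i+1})) says that i_p ∘ φ maps W_{i+1}
to W_i. Expansion and the pigeonhole principle close this backward orbit into a cycle
(`IsDevelopment.exists_period`): W is periodic under i_p ∘ φ, and S(W), its translate by a⁻¹, is
periodic under i_w ∘ φ with w = s⁻¹. As inversion exchanges γ₋ and γ₊, the backward and forward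
claims become one: take a word v with letters of one sign b and a point of Σ_φ periodic under X ↦ v
φ(X). If v ≠ ε, the coordinate of sign b begins with the first letter x of v, and translation by x⁻¹
replaces v by x⁻¹ v φ(x) = γ₊(v) (`step_mem_periodicPts`). Thus iterates of the shift follow
iterates of γ₊.

For (1), a positive boundary point fixed by some i_w ∘ φⁿ has trivial stabilizer
(`eq_one_of_smul_eq_of_mapsTo`), so for given n it determines w; and v can be recovered from any
power of i_w ∘ φ, w = v⁻¹ (`innerCocycle_injective`). Hence points of a common singularity have the
same v (`eq_of_mem_singularity`).

For (2), equal words make both points periodic under the same i_w ∘ φ. Expansion shows that periodic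
points are determined by beginnings of bounded length, so there are finitely many, with a common
period h, and they form a singularity once two first letters differ (`exists_fixesSingularity`).
Minimality of (i, j) supplies this (`exists_letter_ne_of_isLeast`): if the opposite coordinates
began alike, the last step could be undone on both sides; |p|, |s| < |φ(a)| handles the case where
just one index is 0. For v = ε a single letter of each coordinate already determines a periodic
point. -/

theorem mk_letterInv {A : Type*} (x : A × Bool) :
    FreeGroup.mk [letterInv x] = (FreeGroup.mk [x])⁻¹ := by
  simp [letterInv, FreeGroup.inv_mk, FreeGroup.invRev]

theorem mk_cons_eq_mul {A : Type*} (x : A × Bool) (L : List (A × Bool)) :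
    FreeGroup.mk (x :: L) = FreeGroup.mk [x] * FreeGroup.mk L := by
  simp [FreeGroup.mul_mk]

theorem mk_append_eq_mul {A : Type*} (L L' : List (A × Bool)) :
    FreeGroup.mk (L ++ L') = FreeGroup.mk L * FreeGroup.mk L' := by
  simp [FreeGroup.mul_mk]

variable {A : Type*} [DecidableEq A]

theorem FreeGroup.IsReduced.toWord_mk_eq {L : List (A × Bool)} (h : FreeGroup.IsReduced L) :
    (FreeGroup.mk L).toWord = L := by
  rw [FreeGroup.toWord_mk, h.reduce_eq]

theorem toWord_letter_mul_of_head {x : A × Bool} {g : FreeGroup A}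
    (h : g.toWord[0]? = some (letterInv x)) : (FreeGroup.mk [x] * g).toWord = g.toWord.tail := by
  have hx : FreeGroup.mk [x] * g = FreeGroup.mk (x :: g.toWord) := by
    rw [mk_cons_eq_mul x g.toWord, FreeGroup.mk_toWord]
  rw [hx, FreeGroup.toWord_mk, FreeGroup.reduce.cons, FreeGroup.reduce_toWord]
  cases hg : g.toWord with
  | nil => simp [hg] at h
  | cons y T =>
    simp only [hg, List.getElem?_cons_zero, Option.some.injEq] at h
    subst h
    simp [letterInv]

theorem toWord_letter_mul_of_head_ne {x : A × Bool} {g : FreeGroup A}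
    (h : g.toWord[0]? ≠ some (letterInv x)) : (FreeGroup.mk [x] * g).toWord = x :: g.toWord := by
  have hx : FreeGroup.mk [x] * g = FreeGroup.mk (x :: g.toWord) := by
    rw [mk_cons_eq_mul x g.toWord, FreeGroup.mk_toWord]
  rw [hx, FreeGroup.toWord_mk, FreeGroup.reduce.cons, FreeGroup.reduce_toWord]
  cases hg : g.toWord with
  | nil => rfl
  | cons y T =>
    simp only [hg, List.getElem?_cons_zero, ne_eq, Option.some.injEq] at h
    have : ¬ (x.1 = y.1 ∧ x.2 = !y.2) := by
      rintro ⟨h1, h2⟩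
      exact h (Prod.ext h1.symm (by simp [letterInv, h2]))
    simp [this]

/-- The new letter is either appended or cancels the last letter, so only the last position can
change. -/
theorem toWord_mul_letter_getElem? {x : A × Bool} {g : FreeGroup A} {i : ℕ}
    (hi : i + 1 < g.norm) : (g * FreeGroup.mk [x]).toWord[i]? = g.toWord[i]? := by
  have hr : FreeGroup.IsReduced g.toWord := FreeGroup.isReduced_toWord
  have hx : g * FreeGroup.mk [x] = FreeGroup.mk (g.toWord ++ [x]) := by
    rw [mk_append_eq_mul, FreeGroup.mk_toWord]
  rw [hx]
  unfold FreeGroup.norm at hi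
  rcases List.eq_nil_or_concat g.toWord with h | ⟨L, y, h⟩
  · simp [h] at hi
  · rw [List.concat_eq_append] at h
    rw [h] at hr hi ⊢
    simp only [List.length_append, List.length_cons, List.length_nil] at hi
    by_cases hy : y = letterInv x
    · have h1 : FreeGroup.mk (L ++ [y] ++ [x]) = FreeGroup.mk L := by
        rw [mk_append_eq_mul, mk_append_eq_mul, hy, mk_letterInv, inv_mul_cancel_right]
      have h2 : FreeGroup.IsReduced L := hr.infix (List.prefix_append _ _).isInfix
      rw [h1, h2.toWord_mk_eq, List.getElem?_append_left (by omega)]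
    · have h2 : FreeGroup.IsReduced (L ++ [y] ++ [x]) := by
        refine hr.append_overlap ?_ (by simp)
        simp only [List.singleton_append, FreeGroup.isReduced_cons_cons,
          FreeGroup.IsReduced.singleton, and_true]
        intro h1
        by_contra h3
        apply hy
        refine Prod.ext h1 ?_
        simp only [letterInv]
        cases hy2 : y.2 <;> cases hx2 : x.2 <;> simp_all
      rw [h2.toWord_mk_eq, List.getElem?_append_left (by simp; omega)]

theorem norm_mul_ge (g h : FreeGroup A) : g.norm ≤ (g * h).norm + h.norm := by
  calc g.norm = (g * h * h⁻¹).norm := by rw [mul_inv_cancel_right]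
    _ ≤ (g * h).norm + h⁻¹.norm := FreeGroup.norm_mul_le _ _
    _ = _ := by rw [FreeGroup.norm_inv_eq]

theorem toWord_mul_mk_getElem? (L : List (A × Bool)) {g : FreeGroup A} {i : ℕ}
    (hi : i + L.length < g.norm) : (g * FreeGroup.mk L).toWord[i]? = g.toWord[i]? := by
  induction L generalizing g with
  | nil => rw [← FreeGroup.one_eq_mk, mul_one]
  | cons x L ih =>
    rw [List.length_cons] at hi
    rw [mk_cons_eq_mul, ← mul_assoc, ih, toWord_mul_letter_getElem? (by omega)]
    have h1 := norm_mul_ge g (FreeGroup.mk [x])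
    have h2 : (FreeGroup.mk [x]).norm ≤ 1 := FreeGroup.norm_mk_le
    omega

/-- The beginning of a reduced word does not change under right multiplication. -/
theorem toWord_mul_getElem? {g h : FreeGroup A} {i : ℕ} (hi : i + h.norm < g.norm) :
    (g * h).toWord[i]? = g.toWord[i]? := by
  have := toWord_mul_mk_getElem? h.toWord (g := g) (i := i) hi
  rwa [FreeGroup.mk_toWord] at this

/-! ### Lipschitz constants -/

/-- A Lipschitz constant of an automorphism for the word norm. -/
theorem exists_norm_map_le [Finite A] (ψ : MulAut (FreeGroup A)) :
    ∃ K : ℕ, ∀ g, (ψ g).norm ≤ K * g.norm := by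
  obtain ⟨K, hK⟩ := (Set.finite_range fun x : A × Bool => (ψ (FreeGroup.mk [x])).norm).bddAbove
  refine ⟨K, fun g => ?_⟩
  have key : ∀ L : List (A × Bool), (ψ (FreeGroup.mk L)).norm ≤ K * L.length := by
    intro L
    induction L with
    | nil => simp [← FreeGroup.one_eq_mk]
    | cons x L ih =>
      rw [mk_cons_eq_mul, map_mul]
      refine (FreeGroup.norm_mul_le _ _).trans ?_
      have := hK ⟨x, rfl⟩
      simp only at this
      rw [List.length_cons, mul_add, mul_one]
      omega
  have := key g.toWord
  rwa [FreeGroup.mk_toWord] at this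

/-- Continuity of automorphisms at infinity: words with a long common beginning have images with a
long common beginning. -/
theorem exists_map_append_getElem? [Finite A] (ψ : MulAut (FreeGroup A)) (m : ℕ) :
    ∃ M : ℕ, ∀ C T : List (A × Bool), M ≤ C.length → FreeGroup.IsReduced (C ++ T) →
      ∀ i < m, (ψ (FreeGroup.mk (C ++ T))).toWord[i]? = (ψ (FreeGroup.mk C)).toWord[i]? := by
  obtain ⟨K, hK⟩ := exists_norm_map_le ψ
  obtain ⟨K', hK'⟩ := exists_norm_map_le ψ⁻¹
  -- `K'` controls the inverse: a word longer than `K' * (m + K)` has an image longer than `m + K`.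
  -- Appending one letter multiplies that image by an element of norm at most `K`, which leaves the
  -- first `m` letters intact.
  refine ⟨K' * (m + K) + 1, fun C T hC => ?_⟩
  induction T using List.reverseRecOn with
  | nil => intro _ i _; rw [List.append_nil]
  | append_singleton T x ih =>
    intro hr i hi
    rw [← List.append_assoc] at hr
    have hr' : FreeGroup.IsReduced (C ++ T) := hr.infix (List.prefix_append _ _).isInfix
    rw [← List.append_assoc, mk_append_eq_mul, map_mul, toWord_mul_getElem?, ih hr' i hi]
    have h1 := hK (FreeGroup.mk [x])
    have h2 : (FreeGroup.mk [x]).norm ≤ 1 := FreeGroup.norm_mk_le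
    have h3 := hK' (ψ (FreeGroup.mk (C ++ T)))
    rw [MulAut.inv_apply_self] at h3
    have h4 : (FreeGroup.mk (C ++ T)).norm = C.length + T.length := by
      rw [FreeGroup.norm, hr'.toWord_mk_eq, List.length_append]
    have h5 : K * (FreeGroup.mk [x]).norm ≤ K * 1 := Nat.mul_le_mul_left _ h2
    have h6 : m + K < (ψ (FreeGroup.mk (C ++ T))).norm := by
      by_contra h7
      have := Nat.mul_le_mul_left K' (not_lt.1 h7)
      omega
    omega

end Words

/-! ### Convergence to boundary points -/

section Convergence

theorem Boundary.isReduced_map_range {A : Type*} (X : Boundary A) (n : ℕ) :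
    FreeGroup.IsReduced ((List.range n).map X.letter) := by
  induction n with
  | zero => simp
  | succ n ih =>
    cases n with
    | zero => simp
    | succ n =>
      rw [List.range_succ, List.map_append, List.range_succ, List.map_append]
      rw [List.range_succ, List.map_append] at ih
      refine ih.append_overlap ?_ (by simp)
      simp only [List.map_cons, List.map_nil, List.singleton_append, FreeGroup.isReduced_cons_cons,
        FreeGroup.IsReduced.singleton, and_true]
      intro h1
      by_contra h2
      apply X.reduced n
      refine Prod.ext h1.symm ?_
      simp only [letterInv]
      cases h3 : (X.letter n).2 <;> cases h4 : (X.letter (n + 1)).2 <;> simp_all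

variable {A : Type*} [DecidableEq A]

theorem Boundary.toWord_initialWord (X : Boundary A) (n : ℕ) :
    (X.initialWord n).toWord = (List.range n).map X.letter :=
  (X.isReduced_map_range n).toWord_mk_eq

theorem Boundary.convergesTo_initialWord (X : Boundary A) : ConvergesTo X.initialWord X := by
  intro m
  filter_upwards [eventually_ge_atTop m] with n hn i hi
  rw [X.toWord_initialWord]
  simp [List.getElem?_range (show i < n by omega)]

theorem ConvergesTo.unique {u : ℕ → FreeGroup A} {X Y : Boundary A} (h : ConvergesTo u X)
    (h' : ConvergesTo u Y) : X = Y := by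
  ext1
  funext i
  obtain ⟨n, h1, h2⟩ := ((h (i + 1)).and (h' (i + 1))).exists
  have := (h1 i (by omega)).symm.trans (h2 i (by omega))
  simpa using this

theorem ConvergesTo.letter_smul {u : ℕ → FreeGroup A} {X : Boundary A} (h : ConvergesTo u X)
    (x : A × Bool) :
    ConvergesTo (fun n => FreeGroup.mk [x] * u n) (FreeGroup.mk [x] • X) := by
  intro m
  rw [Boundary.mk_singleton_smul]
  filter_upwards [h (m + 1)] with n hn i hi
  by_cases hx : X.letter 0 = letterInv x
  · rw [Boundary.letterMul, dif_pos hx, toWord_letter_mul_of_head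
      ((hn 0 (by omega)).trans (by rw [hx])), List.getElem?_tail, hn (i + 1) (by omega)]
    rfl
  · rw [Boundary.letterMul, dif_neg hx, toWord_letter_mul_of_head_ne]
    · cases i with
      | zero => rfl
      | succ i => rw [List.getElem?_cons_succ, hn i (by omega)]; rfl
    · rw [hn 0 (by omega)]
      simpa using hx

/-- Left translations are continuous at infinity. -/
theorem ConvergesTo.smul {u : ℕ → FreeGroup A} {X : Boundary A} (h : ConvergesTo u X)
    (g : FreeGroup A) : ConvergesTo (fun n => g * u n) (g • X) := by
  have key : ∀ L : List (A × Bool),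
      ConvergesTo (fun n => FreeGroup.mk L * u n) (FreeGroup.mk L • X) := by
    intro L
    induction L with
    | nil => simpa [← FreeGroup.one_eq_mk] using h
    | cons x L ih =>
      rw [mk_cons_eq_mul, mul_smul]
      simpa only [mul_assoc] using ih.letter_smul x
  have := key g.toWord
  rwa [FreeGroup.mk_toWord] at this

/-- Right multiplication by a fixed element does not change the limit. -/
theorem ConvergesTo.mul_right {u : ℕ → FreeGroup A} {X : Boundary A} (h : ConvergesTo u X)
    (g : FreeGroup A) : ConvergesTo (fun n => u n * g) X := by
  intro m
  filter_upwards [h (m + g.norm + 1)] with n hn i hi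
  rw [toWord_mul_getElem?, hn i (by omega)]
  have := hn (m + g.norm) (by omega)
  obtain ⟨h1, -⟩ := List.getElem?_eq_some_iff.1 this
  unfold FreeGroup.norm at *
  omega

theorem map_append_of_convergesTo {u : ℕ → FreeGroup A} {X : Boundary A} (h : ConvergesTo u X)
    (M : ℕ) : ∀ᶠ n in atTop, ∃ T, (u n).toWord = (X.initialWord M).toWord ++ T := by
  filter_upwards [h M] with n hn
  refine ⟨(u n).toWord.drop M, ?_⟩
  conv_lhs => rw [← List.take_append_drop M (u n).toWord]
  congr 1
  rw [X.toWord_initialWord]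
  apply List.ext_getElem?
  intro i
  by_cases hi : i < M
  · rw [List.getElem?_take_of_lt hi, hn i hi]
    simp [List.getElem?_range hi]
  · rw [List.getElem?_eq_none (by simp; omega), List.getElem?_eq_none (by simp; omega)]

/-- The extension of an automorphism to the boundary is continuous. -/
theorem BoundaryMapsTo.convergesTo [Finite A] {ψ : MulAut (FreeGroup A)} {X Y : Boundary A}
    (hψ : BoundaryMapsTo ψ X Y) {u : ℕ → FreeGroup A} (h : ConvergesTo u X) :
    ConvergesTo (fun n => ψ (u n)) Y := by
  intro m
  obtain ⟨M, hM⟩ := exists_map_append_getElem? ψ m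
  -- All sequences tending to X are compared with the single word ψ(X₀ ⋯ X_{M-1}).
  have key : ∀ v : ℕ → FreeGroup A, ConvergesTo v X → ∀ᶠ n in atTop, ∀ i < m,
      (ψ (v n)).toWord[i]? = (ψ (X.initialWord M)).toWord[i]? := by
    intro v hv
    filter_upwards [map_append_of_convergesTo hv M] with n ⟨T, hT⟩ i hi
    have hr : FreeGroup.IsReduced (v n).toWord := FreeGroup.isReduced_toWord
    rw [hT] at hr
    have := hM _ T (by simp [X.toWord_initialWord]) hr i hi
    rwa [← hT, FreeGroup.mk_toWord, FreeGroup.mk_toWord] at this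
  obtain ⟨n₀, h1, h2⟩ := ((key _ X.convergesTo_initialWord).and (hψ m)).exists
  filter_upwards [key u h] with n hn i hi
  rw [hn i hi, ← h1 i hi, h2 i hi]

theorem BoundaryMapsTo.unique {ψ : MulAut (FreeGroup A)} {X Y Y' : Boundary A}
    (h : BoundaryMapsTo ψ X Y) (h' : BoundaryMapsTo ψ X Y') : Y = Y' :=
  ConvergesTo.unique h h'

theorem BoundaryMapsTo.one (X : Boundary A) : BoundaryMapsTo 1 X X :=
  X.convergesTo_initialWord

theorem BoundaryMapsTo.comp [Finite A] {ψ χ : MulAut (FreeGroup A)} {X Y Z : Boundary A}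
    (hχ : BoundaryMapsTo χ Y Z) (hψ : BoundaryMapsTo ψ X Y) : BoundaryMapsTo (χ * ψ) X Z :=
  hχ.convergesTo hψ

theorem BoundaryMapsTo.smul [Finite A] {ψ : MulAut (FreeGroup A)} {X Y : Boundary A}
    (h : BoundaryMapsTo ψ X Y) (g : FreeGroup A) : BoundaryMapsTo ψ (g • X) (ψ g • Y) := by
  have h1 : ConvergesTo (fun n => g⁻¹ * (g • X).initialWord n) X := by
    have := ((g • X).convergesTo_initialWord).smul g⁻¹
    rwa [inv_smul_smul] at this
  have h2 := (h.convergesTo h1).smul (ψ g)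
  simpa [BoundaryMapsTo] using h2

/-- In w⁻¹ u w the right factor is invisible in the limit, so i_w acts on the boundary as
translation by w⁻¹. -/
theorem BoundaryMapsTo.innerAut (w : FreeGroup A) (X : Boundary A) :
    BoundaryMapsTo (innerAut w) X (w⁻¹ • X) := by
  have := (X.convergesTo_initialWord.smul w⁻¹).mul_right w
  simpa [BoundaryMapsTo, _root_.innerAut] using this

theorem boundaryMapsTo_innerAut_mul_iff [Finite A] {φ : MulAut (FreeGroup A)} {w : FreeGroup A}
    {X Y : Boundary A} :
    BoundaryMapsTo (innerAut w * φ) X Y ↔ BoundaryMapsTo φ X (w • Y) := by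
  constructor
  · intro h
    have := (BoundaryMapsTo.innerAut w⁻¹ Y).comp h
    rwa [← mul_assoc, innerAut, innerAut, ← map_mul, inv_inv, mul_inv_cancel, map_one,
      one_mul] at this
  · intro h
    have := (BoundaryMapsTo.innerAut w (w • Y)).comp h
    rwa [inv_smul_smul] at this

/-- The image of a boundary point under the powers of an automorphism. -/
theorem BoundaryMapsTo.pow [Finite A] {ψ : MulAut (FreeGroup A)} {X : Boundary A}
    (h : BoundaryMapsTo ψ X X) (n : ℕ) : BoundaryMapsTo (ψ ^ n) X X := by
  induction n with
  | zero => exact .one X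
  | succ n ih => rw [pow_succ]; exact ih.comp h

theorem DoubleMapsTo.pow [Finite A] {ψ : MulAut (FreeGroup A)} {Z : DoubleBoundary A}
    (h : DoubleMapsTo ψ Z Z) (n : ℕ) : DoubleMapsTo (ψ ^ n) Z Z :=
  ⟨h.1.pow n, h.2.pow n⟩

/-! ### Common beginnings of boundary points -/

/-- Translation by `g` shortens the common beginning of two boundary points by at most `|g|`. -/
theorem Boundary.smul_letter_eq {m : ℕ} (g : FreeGroup A) {X Y : Boundary A}
    (h : ∀ i < m + g.norm, X.letter i = Y.letter i) :
    ∀ i < m, (g • X).letter i = (g • Y).letter i := by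
  have key : ∀ (L : List (A × Bool)) (m : ℕ), (∀ i < m + L.length, X.letter i = Y.letter i) →
      ∀ i < m, (FreeGroup.mk L • X).letter i = (FreeGroup.mk L • Y).letter i := by
    intro L
    induction L with
    | nil => intro m h i hi; simpa [← FreeGroup.one_eq_mk] using h i (by simpa using hi)
    | cons x L ih =>
      intro m h i hi
      have h' := ih (m + 1) (fun i hi => h i (by simp at hi ⊢; omega))
      rw [mk_cons_eq_mul, mul_smul, mul_smul, Boundary.mk_singleton_smul,
        Boundary.mk_singleton_smul]
      have h0 := h' 0 (by omega)
      by_cases hx : (FreeGroup.mk L • X).letter 0 = letterInv x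
      · rw [letterMul, letterMul, dif_pos hx, dif_pos (h0 ▸ hx)]
        exact h' (i + 1) (by omega)
      · rw [letterMul, letterMul, dif_neg hx, dif_neg (h0 ▸ hx)]
        cases i with
        | zero => rfl
        | succ i => exact h' i (by omega)
  have := key g.toWord m h
  rwa [FreeGroup.mk_toWord] at this

end Convergence

/-! ### Words and boundary points with letters of one sign -/

section Sign

variable {A : Type*} [DecidableEq A]

/-- All letters of `g` have sign `b`. -/
def HasSign (b : Bool) (g : FreeGroup A) : Prop := ∀ x ∈ g.toWord, x.2 = b

theorem isReduced_of_sign {A : Type*} {b : Bool} {L : List (A × Bool)} (h : ∀ x ∈ L, x.2 = b) :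
    FreeGroup.IsReduced L := by
  induction L with
  | nil => simp
  | cons x L ih =>
    cases L with
    | nil => simp
    | cons y L =>
      rw [FreeGroup.isReduced_cons_cons]
      refine ⟨fun _ => ?_, ih fun z hz => h z (List.mem_cons_of_mem _ hz)⟩
      rw [h x (by simp), h y (by simp)]

theorem toWord_mk_of_sign {b : Bool} {L : List (A × Bool)} (h : ∀ x ∈ L, x.2 = b) :
    (FreeGroup.mk L).toWord = L :=
  (isReduced_of_sign h).toWord_mk_eq

theorem hasSign_mk {b : Bool} {L : List (A × Bool)} (h : ∀ x ∈ L, x.2 = b) :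
    HasSign b (FreeGroup.mk L) := by
  rwa [HasSign, toWord_mk_of_sign h]

theorem HasSign.one (b : Bool) : HasSign b (1 : FreeGroup A) := by simp [HasSign]

/-- Letters of the same sign never cancel. Every later length computation rests on this additivity.
-/
theorem HasSign.toWord_mul {b : Bool} {g h : FreeGroup A} (hg : HasSign b g) (hh : HasSign b h) :
    (g * h).toWord = g.toWord ++ h.toWord := by
  have : ∀ x ∈ g.toWord ++ h.toWord, x.2 = b := by
    intro x hx
    rcases List.mem_append.1 hx with hx | hx
    exacts [hg x hx, hh x hx]
  rw [FreeGroup.toWord_mul, (isReduced_of_sign this).reduce_eq]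

theorem HasSign.norm_mul {b : Bool} {g h : FreeGroup A} (hg : HasSign b g) (hh : HasSign b h) :
    (g * h).norm = g.norm + h.norm := by
  rw [FreeGroup.norm, hg.toWord_mul hh, List.length_append]; rfl

theorem HasSign.mul {b : Bool} {g h : FreeGroup A} (hg : HasSign b g) (hh : HasSign b h) :
    HasSign b (g * h) := by
  intro x hx
  rw [hg.toWord_mul hh] at hx
  rcases List.mem_append.1 hx with hx | hx
  exacts [hg x hx, hh x hx]

theorem HasSign.inv {b : Bool} {g : FreeGroup A} (hg : HasSign b g) : HasSign (!b) g⁻¹ := by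
  intro x hx
  simp only [FreeGroup.toWord_inv, FreeGroup.invRev, List.mem_reverse, List.mem_map] at hx
  obtain ⟨y, hy, rfl⟩ := hx
  simp [hg y hy]

theorem HasSign.list_prod {b : Bool} {L : List (FreeGroup A)} (h : ∀ g ∈ L, HasSign b g) :
    HasSign b L.prod := by
  induction L with
  | nil => exact .one b
  | cons g L ih =>
    rw [List.prod_cons]
    exact (h g (by simp)).mul (ih fun g hg => h g (List.mem_cons_of_mem _ hg))

variable {φ : MulAut (FreeGroup A)}

theorem hasSign_map_letter (hpos : IsPositiveAut φ) (x : A × Bool) :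
    HasSign x.2 (φ (FreeGroup.mk [x])) := by
  obtain ⟨a, b⟩ := x
  cases b
  · have : FreeGroup.mk [(a, false)] = (FreeGroup.of a)⁻¹ := rfl
    rw [this, map_inv]
    exact HasSign.inv (b := true) (hpos a).2
  · exact (hpos a).2

theorem norm_map_letter (φ : MulAut (FreeGroup A)) (x : A × Bool) :
    (φ (FreeGroup.mk [x])).norm = (φ (FreeGroup.of x.1)).norm := by
  obtain ⟨a, b⟩ := x
  cases b
  · have : FreeGroup.mk [(a, false)] = (FreeGroup.of a)⁻¹ := rfl
    rw [this, map_inv, FreeGroup.norm_inv_eq]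
  · rfl

theorem HasSign.map (hpos : IsPositiveAut φ) {b : Bool} {g : FreeGroup A} (hg : HasSign b g) :
    HasSign b (φ g) := by
  have key : ∀ L : List (A × Bool), (∀ x ∈ L, x.2 = b) → HasSign b (φ (FreeGroup.mk L)) := by
    intro L hL
    induction L with
    | nil => simpa [← FreeGroup.one_eq_mk] using HasSign.one b
    | cons x L ih =>
      rw [mk_cons_eq_mul, map_mul]
      have := hasSign_map_letter hpos x
      rw [hL x (by simp)] at this
      exact this.mul (ih fun y hy => hL y (List.mem_cons_of_mem _ hy))
  have := key g.toWord hg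
  rwa [FreeGroup.mk_toWord] at this

theorem HasSign.norm_map (hpos : IsPositiveAut φ) {b : Bool} {g : FreeGroup A} (hg : HasSign b g) :
    (φ g).norm = (g.toWord.map fun x => (φ (FreeGroup.of x.1)).norm).sum := by
  have key : ∀ L : List (A × Bool), (∀ x ∈ L, x.2 = b) →
      (φ (FreeGroup.mk L)).norm = (L.map fun x => (φ (FreeGroup.of x.1)).norm).sum := by
    intro L hL
    induction L with
    | nil => simp [← FreeGroup.one_eq_mk]
    | cons x L ih =>
      have hL' : ∀ y ∈ L, y.2 = b := fun y hy => hL y (List.mem_cons_of_mem _ hy)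
      have := hasSign_map_letter hpos x
      rw [hL x (by simp)] at this
      rw [mk_cons_eq_mul, map_mul, this.norm_mul ((hasSign_mk hL').map hpos), ih hL',
        List.map_cons, List.sum_cons, norm_map_letter]
  have := key g.toWord hg
  rwa [FreeGroup.mk_toWord] at this

theorem IsPositiveAut.one_le_norm (hpos : IsPositiveAut φ) (a : A) :
    1 ≤ (φ (FreeGroup.of a)).norm :=
  Nat.one_le_iff_ne_zero.2 (by rw [ne_eq, FreeGroup.norm_eq_zero]; exact (hpos a).1)

theorem HasSign.norm_le_norm_map (hpos : IsPositiveAut φ) {b : Bool} {g : FreeGroup A}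
    (hg : HasSign b g) : g.norm ≤ (φ g).norm := by
  rw [hg.norm_map hpos, FreeGroup.norm]
  have := List.card_nsmul_le_sum (g.toWord.map fun x => (φ (FreeGroup.of x.1)).norm) 1 (by
    intro x hx
    obtain ⟨y, -, rfl⟩ := List.mem_map.1 hx
    exact hpos.one_le_norm _)
  simpa using this

theorem IsPositiveAut.pow (hpos : IsPositiveAut φ) (n : ℕ) : IsPositiveAut (φ ^ n) := by
  intro a
  refine ⟨by simp, ?_⟩
  change HasSign true _
  induction n with
  | zero => intro x hx; simp at hx; simp [hx]
  | succ n ih => rw [pow_succ']; exact ih.map hpos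

theorem Boundary.initialWord_add {A : Type*} (X : Boundary A) (m n : ℕ) :
    X.initialWord (m + n) =
      X.initialWord m * FreeGroup.mk ((List.range n).map fun i => X.letter (m + i)) := by
  rw [initialWord, List.range_add, List.map_append, mk_append_eq_mul, List.map_map]
  rfl

/-- A boundary point with letters of sign `b`. -/
def Boundary.HasSign {A : Type*} (b : Bool) (X : Boundary A) : Prop := ∀ i, (X.letter i).2 = b

theorem Boundary.HasSign.initialWord {b : Bool} {X : Boundary A} (hX : X.HasSign b) (n : ℕ) :
    _root_.HasSign b (X.initialWord n) :=
  hasSign_mk fun x hx => by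
    obtain ⟨i, -, rfl⟩ := List.mem_map.1 hx
    exact hX i

/-- The image of a boundary point with letters of one sign begins with the images of its
beginnings. -/
theorem BoundaryMapsTo.getElem?_eq (hpos : IsPositiveAut φ) {b : Bool} {X Y : Boundary A}
    (hX : X.HasSign b) (h : BoundaryMapsTo φ X Y) (m : ℕ) {i : ℕ}
    (hi : i < (φ (X.initialWord m)).norm) :
    (φ (X.initialWord m)).toWord[i]? = some (Y.letter i) := by
  obtain ⟨n, hn, hmn⟩ := ((h (i + 1)).and (eventually_ge_atTop m)).exists
  obtain ⟨n, rfl⟩ := Nat.exists_eq_add_of_le hmn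
  have hn' := hn i (by omega)
  simp only at hn'
  rw [← hn', X.initialWord_add, map_mul,
    ((hX.initialWord m).map hpos).toWord_mul, List.getElem?_append_left hi]
  refine HasSign.map hpos (hasSign_mk fun x hx => ?_)
  obtain ⟨i, -, rfl⟩ := List.mem_map.1 hx
  exact hX _

/-! ### Powers of `i_w ∘ φ` -/

/-- The word `φⁿ⁻¹(w) ⋯ φ(w) w`. -/
def innerCocycle {A : Type*} (φ : MulAut (FreeGroup A)) (w : FreeGroup A) : ℕ → FreeGroup A
  | 0 => 1
  | n + 1 => (φ ^ n) w * innerCocycle φ w n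

theorem innerAut_mul_innerAut {A : Type*} (v w : FreeGroup A) :
    innerAut v * innerAut w = innerAut (w * v) := by
  rw [innerAut, innerAut, innerAut, ← map_mul, mul_inv_rev]

theorem mul_innerAut {A : Type*} (φ : MulAut (FreeGroup A)) (w : FreeGroup A) :
    φ * innerAut w = innerAut (φ w) * φ := by
  ext g
  simp [innerAut]

/-- Powers of i_w ∘ φ are again of the form i_c ∘ φⁿ, with c carrying all the dependence on w. -/
theorem innerAut_mul_pow {A : Type*} (φ : MulAut (FreeGroup A)) (w : FreeGroup A) (n : ℕ) :
    (innerAut w * φ) ^ n = innerAut (innerCocycle φ w n) * φ ^ n := by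
  induction n with
  | zero => simp [innerCocycle, innerAut]
  | succ n ih =>
    rw [pow_succ, ih, mul_assoc, ← mul_assoc (φ ^ n), mul_innerAut, mul_assoc, ← pow_succ,
      ← mul_assoc, innerAut_mul_innerAut, innerCocycle]

theorem innerCocycle_one {A : Type*} (φ : MulAut (FreeGroup A)) (n : ℕ) :
    innerCocycle φ 1 n = 1 := by
  induction n with
  | zero => rfl
  | succ n ih => rw [innerCocycle, ih, map_one, mul_one]

/-- This second recursion exhibits w as the right-hand end of the cocycle. -/
theorem innerCocycle_succ' {A : Type*} (φ : MulAut (FreeGroup A)) (w : FreeGroup A) (n : ℕ) :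
    innerCocycle φ w (n + 1) = φ (innerCocycle φ w n) * w := by
  induction n with
  | zero => simp [innerCocycle]
  | succ n ih =>
    conv_lhs => rw [innerCocycle, ih]
    rw [show innerCocycle φ w (n + 1) = (φ ^ n) w * innerCocycle φ w n from rfl, map_mul,
      pow_succ', MulAut.mul_apply, mul_assoc]

theorem HasSign.innerCocycle (hpos : IsPositiveAut φ) {b : Bool} {w : FreeGroup A}
    (hw : HasSign b w) (n : ℕ) : HasSign b (innerCocycle φ w n) := by
  induction n with
  | zero => exact .one b
  | succ n ih => exact (hw.map (hpos.pow n)).mul ih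

/-- Each of the n factors φᵐ(uv) is φᵐ(u)φᵐ(v) without cancellation and is therefore longer than
φᵐ(v) by at least |u|. -/
theorem norm_innerCocycle_le_of_suffix (hpos : IsPositiveAut φ) {b : Bool} {u v : FreeGroup A}
    (hu : HasSign b u) (hv : HasSign b v) (n : ℕ) :
    (innerCocycle φ v n).norm + n * u.norm ≤ (innerCocycle φ (u * v) n).norm := by
  induction n with
  | zero => simp [innerCocycle]
  | succ n ih =>
    rw [innerCocycle, innerCocycle, (hv.map (hpos.pow n)).norm_mul (hv.innerCocycle hpos n),
      ((hu.mul hv).map (hpos.pow n)).norm_mul ((hu.mul hv).innerCocycle hpos n), map_mul,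
      (hu.map (hpos.pow n)).norm_mul (hv.map (hpos.pow n))]
    have := hu.norm_le_norm_map (hpos.pow n)
    rw [add_mul]
    omega

/-- A word with letters of one sign is determined by `φⁿ⁻¹(w) ⋯ φ(w) w`. -/
theorem innerCocycle_injective (hpos : IsPositiveAut φ) {b : Bool} {u v : FreeGroup A}
    (hu : HasSign b u) (hv : HasSign b v) {n : ℕ} (hn : n ≠ 0)
    (h : innerCocycle φ u n = innerCocycle φ v n) : u = v := by
  have key : ∀ u v : FreeGroup A, HasSign b u → HasSign b v →
      innerCocycle φ u n = innerCocycle φ v n → u.toWord <:+ v.toWord → u = v := by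
    rintro u v hu hv h ⟨L, hL⟩
    have hLs : HasSign b (FreeGroup.mk L) :=
      hasSign_mk fun x hx => hv x (hL ▸ List.mem_append_left _ hx)
    have hv' : v = FreeGroup.mk L * u := by
      rw [← FreeGroup.mk_toWord (x := v), ← hL, mk_append_eq_mul, FreeGroup.mk_toWord]
    have := norm_innerCocycle_le_of_suffix hpos hLs hu n
    rw [← hv', ← h] at this
    have h0 : n * (FreeGroup.mk L).norm = 0 := by omega
    rw [Nat.mul_eq_zero, FreeGroup.norm_eq_zero] at h0
    rw [hv', h0.resolve_left hn, one_mul]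
  obtain ⟨n, rfl⟩ := Nat.exists_eq_succ_of_ne_zero hn
  have hw : ∀ w, HasSign b w → w.toWord <:+ (innerCocycle φ w (n + 1)).toWord := by
    intro w hw
    rw [innerCocycle_succ', ((hw.innerCocycle hpos n).map hpos).toWord_mul hw]
    exact List.suffix_append _ _
  -- Both words end the same cocycle, so one is a suffix of the other; any surplus would make the
  -- cocycles differ in length.
  rcases List.suffix_or_suffix_of_suffix (hw u hu) (h ▸ hw v hv) with h1 | h1
  · exact key u v hu hv h h1
  · exact (key v u hv hu h.symm h1).symm

/-! ### Growth -/

variable [Fintype A]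

/-- The sum of the lengths of the images of the letters under `φᴺ`. -/
def totalLength (φ : MulAut (FreeGroup A)) (N : ℕ) : ℕ :=
  ∑ a, ((φ ^ N) (FreeGroup.of a)).norm

theorem norm_pow_map_le (φ : MulAut (FreeGroup A)) (N : ℕ) (g : FreeGroup A) :
    ((φ ^ N) g).norm ≤ g.norm * totalLength φ N := by
  have key : ∀ L : List (A × Bool),
      ((φ ^ N) (FreeGroup.mk L)).norm ≤ L.length * totalLength φ N := by
    intro L
    induction L with
    | nil => simp [← FreeGroup.one_eq_mk]
    | cons x L ih =>
      rw [mk_cons_eq_mul, map_mul, List.length_cons, add_mul, one_mul]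
      refine (FreeGroup.norm_mul_le _ _).trans ?_
      rw [norm_map_letter, add_comm]
      exact add_le_add ih (Finset.single_le_sum (f := fun a => ((φ ^ N) (FreeGroup.of a)).norm)
        (fun _ _ => Nat.zero_le _) (Finset.mem_univ x.1))
  have := key g.toWord
  rwa [FreeGroup.mk_toWord] at this

/-- As φ(a) contains every letter c, the word φᴺ⁺¹(a) contains every φᴺ(c) as a separate block. -/
theorem totalLength_le_norm (hpos : IsPositiveAut φ)
    (hall : ∀ a b : A, (b, true) ∈ (φ (FreeGroup.of a)).toWord) (N : ℕ) (a : A) :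
    totalLength φ N ≤ ((φ ^ (N + 1)) (FreeGroup.of a)).norm := by
  have h1 : HasSign true (φ (FreeGroup.of a)) := (hpos a).2
  rw [pow_succ, MulAut.mul_apply, h1.norm_map (hpos.pow N)]
  set f : A → ℕ := fun a => ((φ ^ N) (FreeGroup.of a)).norm
  have h2 : ((φ (FreeGroup.of a)).toWord.map fun x => f x.1) =
      ((φ (FreeGroup.of a)).toWord.map Prod.fst).map f := by simp
  change totalLength φ N ≤ ((φ (FreeGroup.of a)).toWord.map fun x => f x.1).sum
  rw [h2, Finset.sum_list_map_count]
  have h3 : ((φ (FreeGroup.of a)).toWord.map Prod.fst).toFinset = Finset.univ := by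
    ext c
    simpa using Or.inr (hall a c)
  rw [h3, totalLength]
  refine Finset.sum_le_sum fun c _ => ?_
  have : 1 ≤ List.count c ((φ (FreeGroup.of a)).toWord.map Prod.fst) :=
    List.one_le_count_iff.2 (List.mem_map.2 ⟨_, hall a c, rfl⟩)
  rw [smul_eq_mul]
  exact Nat.le_mul_of_pos_left _ this

theorem two_mul_totalLength_le (hA : 2 ≤ Fintype.card A) (hpos : IsPositiveAut φ)
    (hall : ∀ a b : A, (b, true) ∈ (φ (FreeGroup.of a)).toWord) (N : ℕ) :
    2 * totalLength φ N ≤ totalLength φ (N + 1) := by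
  calc 2 * totalLength φ N ≤ Fintype.card A * totalLength φ N := Nat.mul_le_mul_right _ hA
    _ = ∑ _a : A, totalLength φ N := by simp
    _ ≤ _ := Finset.sum_le_sum fun a _ => totalLength_le_norm hpos hall N a

theorem lt_totalLength (hA : 2 ≤ Fintype.card A) (hpos : IsPositiveAut φ)
    (hall : ∀ a b : A, (b, true) ∈ (φ (FreeGroup.of a)).toWord) (N : ℕ) :
    N < totalLength φ N := by
  induction N with
  | zero => simp [totalLength]; omega
  | succ N ih => have := two_mul_totalLength_le hA hpos hall N; omega

theorem totalLength_succ_le (φ : MulAut (FreeGroup A)) (N : ℕ) :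
    totalLength φ (N + 1) ≤ totalLength φ 1 * totalLength φ N := by
  rw [totalLength, totalLength, Finset.sum_mul]
  refine Finset.sum_le_sum fun a _ => ?_
  rw [pow_succ, MulAut.mul_apply, pow_one]
  exact norm_pow_map_le φ N _

/-- The total length at least doubles at each step, so the lengths of the factors are dominated by a
geometric sum. -/
theorem norm_innerCocycle_le (hA : 2 ≤ Fintype.card A) (hpos : IsPositiveAut φ)
    (hall : ∀ a b : A, (b, true) ∈ (φ (FreeGroup.of a)).toWord) (w : FreeGroup A) (N : ℕ) :
    (innerCocycle φ w N).norm ≤ w.norm * totalLength φ N := by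
  induction N with
  | zero => simp [innerCocycle]
  | succ N ih =>
    have h1 := norm_pow_map_le φ N w
    have h2 := Nat.mul_le_mul_left w.norm (two_mul_totalLength_le hA hpos hall N)
    have h3 := FreeGroup.norm_mul_le ((φ ^ N) w) (innerCocycle φ w N)
    rw [innerCocycle]
    linarith

theorem HasSign.norm_mul_totalLength_le (hpos : IsPositiveAut φ)
    (hall : ∀ a b : A, (b, true) ∈ (φ (FreeGroup.of a)).toWord) (N : ℕ) {b : Bool}
    {c : FreeGroup A} (hc : HasSign b c) :
    c.norm * totalLength φ N ≤ ((φ ^ (N + 1)) c).norm := by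
  rw [hc.norm_map (hpos.pow (N + 1)), FreeGroup.norm]
  have := List.card_nsmul_le_sum (c.toWord.map fun x => ((φ ^ (N + 1)) (FreeGroup.of x.1)).norm)
    (totalLength φ N) (by
      intro x hx
      obtain ⟨y, -, rfl⟩ := List.mem_map.1 hx
      exact totalLength_le_norm hpos hall N y.1)
  simpa using this

/-! ### Expansion -/

/-- Boundary points with letters of one sign and a sufficiently long common beginning are separated
at a bounded speed only: their images under `(i_w ∘ φ)ᴺ⁺¹` have a common beginning of length more
than `N`. -/
theorem letter_eq_of_mapsTo_pow (hA : 2 ≤ Fintype.card A) (hpos : IsPositiveAut φ)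
    (hall : ∀ a b : A, (b, true) ∈ (φ (FreeGroup.of a)).toWord) (w : FreeGroup A) {b : Bool}
    {X Y X' Y' : Boundary A} (hX : X.HasSign b) (hY : Y.HasSign b)
    (hXY : ∀ i < w.norm * totalLength φ 1 + 1, X.letter i = Y.letter i) (N : ℕ)
    (hX' : BoundaryMapsTo ((innerAut w * φ) ^ (N + 1)) X X')
    (hY' : BoundaryMapsTo ((innerAut w * φ) ^ (N + 1)) Y Y') :
    ∀ i < N + 1, X'.letter i = Y'.letter i := by
  rw [innerAut_mul_pow, boundaryMapsTo_innerAut_mul_iff] at hX' hY'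
  set K := w.norm * totalLength φ 1 with hK
  set c := innerCocycle φ w (N + 1) with hc
  have hXY' : X.initialWord (K + 1) = Y.initialWord (K + 1) := by
    rw [Boundary.initialWord, Boundary.initialWord]
    congr 1
    exact List.map_congr_left fun i hi => hXY i (List.mem_range.1 hi)
  have h1 : ∀ i < ((φ ^ (N + 1)) (X.initialWord (K + 1))).norm,
      (c • X').letter i = (c • Y').letter i := by
    intro i hi
    have e1 := hX'.getElem?_eq (hpos.pow _) hX (K + 1) hi
    have e2 := hY'.getElem?_eq (hpos.pow _) hY (K + 1) (hXY' ▸ hi)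
    rw [hXY'] at e1
    simpa using e1.symm.trans e2
  -- Write T_N for `totalLength φ N`. The common beginning has K + 1 letters, so its image has
  -- length at least (K + 1) T_N, while |c| ≤ |w| T_{N+1} ≤ K T_N. The surplus T_N > N survives
  -- translation by c⁻¹.
  have h2 : N + 1 + c⁻¹.norm ≤ ((φ ^ (N + 1)) (X.initialWord (K + 1))).norm := by
    have e1 := (hX.initialWord (K + 1)).norm_mul_totalLength_le hpos hall N
    have e2 : (X.initialWord (K + 1)).norm = K + 1 := by
      rw [FreeGroup.norm, X.toWord_initialWord]; simp
    have e3 := norm_innerCocycle_le hA hpos hall w (N + 1)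
    have e4 := Nat.mul_le_mul_left w.norm (totalLength_succ_le φ N)
    have e5 := lt_totalLength hA hpos hall N
    rw [e2, add_mul, one_mul] at e1
    rw [← mul_assoc, ← hK] at e4
    rw [FreeGroup.norm_inv_eq, hc]
    omega
  have := Boundary.smul_letter_eq c⁻¹ (m := N + 1) fun i hi => h1 i (by omega)
  simpa only [inv_smul_smul] using this

/-- The version of `letter_eq_of_mapsTo_pow` for a primitive automorphism. -/
theorem exists_letter_eq_of_mapsTo_pow (hA : 2 ≤ Fintype.card A) (hpos : IsPositiveAut φ)
    (hprim : IsPrimitiveAut φ) (w : FreeGroup A) :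
    ∃ k L : ℕ, 1 ≤ k ∧ (w = 1 → L = 1) ∧ ∀ (b : Bool) (X Y X' Y' : Boundary A),
      X.HasSign b → Y.HasSign b → (∀ i < L, X.letter i = Y.letter i) → ∀ N : ℕ,
      BoundaryMapsTo ((innerAut w * φ) ^ (k * (N + 1))) X X' →
      BoundaryMapsTo ((innerAut w * φ) ^ (k * (N + 1))) Y Y' →
      ∀ i < N + 1, X'.letter i = Y'.letter i := by
  obtain ⟨k, hk, hall⟩ := hprim
  -- The bound is that of the single step for φᵏ and the cocycle of length k; for w = 1 the cocycle
  -- is trivial and one letter suffices.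
  refine ⟨k, (innerCocycle φ w k).norm * totalLength (φ ^ k) 1 + 1, hk, ?_, ?_⟩
  · rintro rfl
    simp [innerCocycle_one]
  · intro b X Y X' Y' hX hY h N hX' hY'
    rw [pow_mul, innerAut_mul_pow] at hX' hY'
    exact letter_eq_of_mapsTo_pow hA (hpos.pow k) hall _ hX hY h N hX' hY'

/-- Boundary points with letters of one sign which are periodic under `i_w ∘ φ` are determined by a
beginning of bounded length. -/
theorem exists_eq_of_periodic (hA : 2 ≤ Fintype.card A) (hpos : IsPositiveAut φ)
    (hprim : IsPrimitiveAut φ) (w : FreeGroup A) :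
    ∃ L : ℕ, (w = 1 → L = 1) ∧ ∀ (b : Bool) (X Y : Boundary A) (m n : ℕ), 1 ≤ m → 1 ≤ n →
      X.HasSign b → Y.HasSign b →
      BoundaryMapsTo ((innerAut w * φ) ^ m) X X → BoundaryMapsTo ((innerAut w * φ) ^ n) Y Y →
      (∀ i < L, X.letter i = Y.letter i) → X = Y := by
  obtain ⟨k, L, hk, hL, h⟩ := exists_letter_eq_of_mapsTo_pow hA hpos hprim w
  refine ⟨L, hL, fun b X Y m n hm hn hX hY hXX hYY hXY => ?_⟩
  ext1
  funext i
  -- The exponent has to be a multiple of both periods and large enough to reach position i; the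
  -- form N + 1 is the one that expansion requires.
  have hmn : m * n * (i + 1) = m * n * (i + 1) - 1 + 1 :=
    (Nat.succ_pred_eq_of_pos (by positivity)).symm
  have hle : i + 1 ≤ m * n * (i + 1) := Nat.le_mul_of_pos_left _ (by positivity)
  refine h b X Y X Y hX hY hXY (m * n * (i + 1) - 1) ?_ ?_ i (by omega)
  · rw [← hmn, show k * (m * n * (i + 1)) = m * (k * n * (i + 1)) by ring, pow_mul]
    exact hXX.pow _
  · rw [← hmn, show k * (m * n * (i + 1)) = n * (k * m * (i + 1)) by ring, pow_mul]
    exact hYY.pow _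

end Sign

/-! ### The two coordinates of a point of the double boundary -/

section Coordinates

variable {A : Type*} [DecidableEq A]

/-- The coordinates of a point of `∂²F`: the second one for `true`, the first one for `false`. -/
def coord {A : Type*} : Bool → DoubleBoundary A → Boundary A
  | true, Z => Z.1.2
  | false, Z => Z.1.1

theorem doubleBoundary_ext {A : Type*} {Z Z' : DoubleBoundary A} (h : ∀ c, coord c Z = coord c Z') :
    Z = Z' :=
  Subtype.ext (Prod.ext (h false) (h true))

theorem doubleMapsTo_iff {ψ : MulAut (FreeGroup A)} {Z Z' : DoubleBoundary A} :
    DoubleMapsTo ψ Z Z' ↔ ∀ c, BoundaryMapsTo ψ (coord c Z) (coord c Z') :=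
  ⟨fun h c => by cases c; exacts [h.1, h.2], fun h => ⟨h false, h true⟩⟩

theorem coord_translatePoint (g : FreeGroup A) (Z : DoubleBoundary A) (c : Bool) :
    coord c (translatePoint g Z) = g • coord c Z := by cases c <;> rfl

/-- Translation by the inverse of the first letter of a coordinate: the shift for `true` and its
inverse for `false`. -/
def step (b : Bool) (Z : DoubleBoundary A) : DoubleBoundary A :=
  translatePoint (FreeGroup.mk [(coord b Z).letter 0])⁻¹ Z

theorem coord_step_self (b : Bool) (Z : DoubleBoundary A) :
    coord b (step b Z) = (coord b Z).tail := by
  rw [step, coord_translatePoint, mk_inv_smul, Boundary.letterMul,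
    dif_pos (letterInv_letterInv _).symm]

/-- The letters of the first coordinate are negative, those of the second one are positive. -/
def IsOriented {A : Type*} (Z : DoubleBoundary A) : Prop := ∀ c, (coord c Z).HasSign c

theorem IsOriented.ne_letter {A : Type*} {Z : DoubleBoundary A} (h : IsOriented Z) (b : Bool)
    (i j : ℕ) : (coord (!b) Z).letter i ≠ (coord b Z).letter j := by
  intro h'
  have h1 := h (!b) i
  rw [h', h b j] at h1
  cases b <;> simp at h1

theorem IsOriented.coord_step_not {Z : DoubleBoundary A} (h : IsOriented Z) (b : Bool) :
    (coord (!b) (step b Z)).letter =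
      fun i => Nat.casesOn i (letterInv ((coord b Z).letter 0)) (coord (!b) Z).letter := by
  rw [step, coord_translatePoint, mk_inv_smul, Boundary.letterMul, dif_neg]
  · rfl
  · rw [letterInv_letterInv]
    exact h.ne_letter b 0 0

theorem IsOriented.coord_step_not_zero {Z : DoubleBoundary A} (h : IsOriented Z) (b : Bool) :
    (coord (!b) (step b Z)).letter 0 = letterInv ((coord b Z).letter 0) := by
  simp [h.coord_step_not b]

theorem IsOriented.step {Z : DoubleBoundary A} (h : IsOriented Z) (b : Bool) :
    IsOriented (step b Z) := by
  have h1 : (coord b (_root_.step b Z)).HasSign b := by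
    rw [coord_step_self]
    exact fun i => h b (i + 1)
  have h2 : (coord (!b) (_root_.step b Z)).HasSign (!b) := by
    intro i
    rw [h.coord_step_not b]
    cases i with
    | zero => simp [letterInv, h b 0]
    | succ i => exact h (!b) i
  intro c
  cases b <;> cases c <;> assumption

theorem IsOriented.step_iterate {Z : DoubleBoundary A} (h : IsOriented Z) (b : Bool) (n : ℕ) :
    IsOriented ((_root_.step b)^[n] Z) := by
  induction n with
  | zero => exact h
  | succ n ih => rw [Function.iterate_succ_apply']; exact ih.step b

theorem IsOriented.shiftInv_shift {Z : DoubleBoundary A} (h : IsOriented Z) :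
    shiftInv (shift Z) = Z :=
  _root_.shiftInv_shift Z (h.ne_letter true 0 0)

theorem IsOriented.shift_shiftInv {Z : DoubleBoundary A} (h : IsOriented Z) :
    shift (shiftInv Z) = Z :=
  _root_.shift_shiftInv Z (h.ne_letter true 0 0)

theorem IsOriented.shiftPow {Z : DoubleBoundary A} (h : IsOriented Z) (n : ℤ) :
    IsOriented (shiftPow n Z) := by
  cases n with
  | ofNat n => exact h.step_iterate true n
  | negSucc n => exact h.step_iterate false (n + 1)

theorem IsOriented.shiftPow_add_one {Z : DoubleBoundary A} (h : IsOriented Z) (n : ℤ) :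
    _root_.shiftPow (n + 1) Z = shift (_root_.shiftPow n Z) := by
  cases n with
  | ofNat n => exact Function.iterate_succ_apply' _ _ _
  | negSucc n =>
    cases n with
    | zero => exact h.shift_shiftInv.symm
    | succ n =>
      have h1 : Int.negSucc (n + 1) + 1 = Int.negSucc n := by omega
      rw [h1]
      change shiftInv^[n + 1] Z = shift (shiftInv^[n + 1 + 1] Z)
      rw [Function.iterate_succ_apply' _ (n + 1)]
      exact (h.step_iterate false (n + 1)).shift_shiftInv.symm

theorem IsOriented.shiftPow_sub_one {Z : DoubleBoundary A} (h : IsOriented Z) (n : ℤ) :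
    _root_.shiftPow (n - 1) Z = shiftInv (_root_.shiftPow n Z) := by
  have h1 := h.shiftPow_add_one (n - 1)
  rw [sub_add_cancel] at h1
  rw [h1, (h.shiftPow _).shiftInv_shift]

theorem shiftPow_neg_natCast (n : ℕ) (Z : DoubleBoundary A) :
    shiftPow (-(n : ℤ)) Z = (step false)^[n] Z := by
  cases n with
  | zero => rfl
  | succ n => rfl

theorem shiftPow_natCast_add_one (n : ℕ) (Z : DoubleBoundary A) :
    shiftPow ((n : ℤ) + 1) Z = (step true)^[n] (step true Z) := rfl

/-! ### The topology of the double boundary -/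

theorem Boundary.isOpen_letter_eq {A : Type*} (i : ℕ) (x : A × Bool) :
    IsOpen {X : Boundary A | X.letter i = x} := by
  let _ : TopologicalSpace (A × Bool) := ⊥
  have _ : DiscreteTopology (A × Bool) := ⟨rfl⟩
  have h : IsOpen {f : ℕ → A × Bool | f i = x} :=
    (isOpen_discrete ({x} : Set (A × Bool))).preimage
      (continuous_apply (A := fun _ : ℕ => A × Bool) i)
  exact isOpen_induced h

theorem Boundary.tendsto_of_letter_eq {A : Type*} {u : ℕ → Boundary A} {X : Boundary A}
    (h : ∀ i, ∀ᶠ n in atTop, (u n).letter i = X.letter i) : Tendsto u atTop (nhds X) := by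
  let _ : TopologicalSpace (A × Bool) := ⊥
  have hi : Topology.IsInducing (Boundary.letter : Boundary A → ℕ → A × Bool) := ⟨rfl⟩
  rw [hi.tendsto_nhds_iff, tendsto_pi_nhds]
  intro i
  refine tendsto_const_nhds.congr' ?_
  filter_upwards [h i] with n hn
  exact hn.symm

theorem continuous_coord {A : Type*} (c : Bool) :
    Continuous (coord c : DoubleBoundary A → Boundary A) := by
  cases c
  · exact continuous_fst.comp continuous_subtype_val
  · exact continuous_snd.comp continuous_subtype_val

/-- The points of a closure are those approximated to any finite number of letters. -/
theorem mem_closure_iff_letter_eq {A : Type*} {S : Set (DoubleBoundary A)} {W : DoubleBoundary A} :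
    W ∈ closure S ↔
      ∀ m, ∃ Z ∈ S, ∀ c, ∀ i < m, (coord c Z).letter i = (coord c W).letter i := by
  constructor
  · intro h m
    have ho : IsOpen (⋂ c : Bool, ⋂ i : Fin m,
        {Z : DoubleBoundary A | (coord c Z).letter i = (coord c W).letter i}) :=
      isOpen_iInter_of_finite fun c => isOpen_iInter_of_finite fun i =>
        (Boundary.isOpen_letter_eq _ _).preimage (continuous_coord c)
    obtain ⟨Z, hZ, hZS⟩ := mem_closure_iff.1 h _ ho (by simp)
    simp only [Set.mem_iInter] at hZ
    exact ⟨Z, hZS, fun c i hi => hZ c ⟨i, hi⟩⟩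
  · intro h
    choose u hu hc using h
    refine mem_closure_of_tendsto (f := u) (b := atTop) ?_ (Eventually.of_forall hu)
    rw [tendsto_subtype_rng]
    have key : ∀ c, Tendsto (fun n => coord c (u n)) atTop (nhds (coord c W)) := fun c =>
      Boundary.tendsto_of_letter_eq fun i => by
        filter_upwards [eventually_gt_atTop i] with n hn
        exact hc n c i hn
    exact (key false).prodMk_nhds (key true)

/-! ### The attracting subshift -/

variable {φ : MulAut (FreeGroup A)}

theorem ConvergesTo.hasSign {u : ℕ → FreeGroup A} {X : Boundary A} (h : ConvergesTo u X) {b : Bool}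
    (hu : ∀ n, HasSign b (u n)) : X.HasSign b := by
  intro i
  obtain ⟨n, hn⟩ := (h (i + 1)).exists
  exact hu n _ (List.mem_of_getElem? (hn i (by omega)))

theorem IsSeed.isOriented (hpos : IsPositiveAut φ) {Z : DoubleBoundary A} (h : IsSeed φ Z) :
    IsOriented Z := by
  obtain ⟨a, k, p, s, -, hp, hs, -, h1, h2⟩ := h
  intro c
  cases c
  · refine h1.hasSign fun n => HasSign.list_prod fun g hg => ?_
    obtain ⟨m, -, rfl⟩ := List.mem_map.1 hg
    exact HasSign.map (hpos.pow _) (HasSign.inv (b := true) hp.2)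
  · refine h2.hasSign fun n => HasSign.mul ?_ (HasSign.list_prod fun g hg => ?_)
    · exact hasSign_mk (by simp)
    · obtain ⟨m, -, rfl⟩ := List.mem_map.1 hg
      exact HasSign.map (hpos.pow _) hs.2

theorem isOriented_of_mem_attractingSubshift (hpos : IsPositiveAut φ) {W : DoubleBoundary A}
    (h : W ∈ attractingSubshift φ) : IsOriented W := by
  obtain ⟨Z, hZ, hW⟩ := h
  intro c i
  obtain ⟨Z', ⟨n, rfl⟩, h'⟩ := mem_closure_iff_letter_eq.1 hW (i + 1)
  rw [← h' c i (by omega)]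
  exact (hZ.isOriented hpos).shiftPow n c i

theorem step_mem_attractingSubshift (hpos : IsPositiveAut φ) {W : DoubleBoundary A}
    (h : W ∈ attractingSubshift φ) (b : Bool) : step b W ∈ attractingSubshift φ := by
  obtain ⟨Z, hZ, hW⟩ := h
  refine ⟨Z, hZ, mem_closure_iff_letter_eq.2 fun m => ?_⟩
  obtain ⟨Z', ⟨n, rfl⟩, h'⟩ := mem_closure_iff_letter_eq.1 hW (m + 1)
  refine ⟨step b (shiftPow n Z), ?_, fun c => ?_⟩
  · cases b
    · exact ⟨n - 1, (hZ.isOriented hpos).shiftPow_sub_one n⟩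
    · exact ⟨n + 1, (hZ.isOriented hpos).shiftPow_add_one n⟩
  · rw [step, coord_translatePoint, step, coord_translatePoint, h' b 0 (by omega)]
    refine Boundary.smul_letter_eq _ fun i hi => h' c i (hi.trans_le ?_)
    rw [FreeGroup.norm_inv_eq]
    exact Nat.add_le_add_left FreeGroup.norm_mk_le m

/-! ### Constant developments -/

/-- Each shift strips one letter of the second coordinate. Applied to the letters of p, this turns
S^{|p|} into translation by p⁻¹. -/
theorem shift_iterate_eq_translatePoint (L : List (A × Bool))
    (Z : DoubleBoundary A) (h : ∀ i < L.length, L[i]? = some (Z.1.2.letter i)) :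
    shift^[L.length] Z = translatePoint (FreeGroup.mk L)⁻¹ Z := by
  induction L generalizing Z with
  | nil =>
    refine doubleBoundary_ext fun c => ?_
    rw [coord_translatePoint, ← FreeGroup.one_eq_mk, inv_one, one_smul]
    rfl
  | cons x L ih =>
    have h0 : x = Z.1.2.letter 0 := by simpa using h 0 (by simp)
    rw [List.length_cons, Function.iterate_succ_apply, ih]
    · refine doubleBoundary_ext fun c => ?_
      rw [coord_translatePoint, coord_translatePoint, mk_cons_eq_mul, mul_inv_rev, mul_smul, h0,
        shift, coord_translatePoint]
    · intro i hi
      have : (shift Z).1.2 = Z.1.2.tail := coord_step_self true Z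
      rw [this, ← List.getElem?_cons_succ (a := x)]
      exact h (i + 1) (by simpa using hi)

theorem IsDevelopment.isEdge {W : DoubleBoundary A} {p s : FreeGroup A} {a : A}
    (h : IsDevelopment φ W fun _ => (p, a, s)) : IsEdge φ (p, a, s) a := by
  obtain ⟨w, -, hw⟩ := h
  exact (hw 0).2.2.1

theorem IsDevelopment.letter_zero {W : DoubleBoundary A} {p s : FreeGroup A} {a : A}
    (h : IsDevelopment φ W fun _ => (p, a, s)) : (coord true W).letter 0 = (a, true) := by
  obtain ⟨w, rfl, hw⟩ := h
  exact (hw 0).2.1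

/-! ### Periodic points -/

variable [Fintype A]

/-- The points of `Σ_φ` which are periodic under `∂²ψ`. -/
def periodicPts (φ ψ : MulAut (FreeGroup A)) : Set (DoubleBoundary A) :=
  {Z | Z ∈ attractingSubshift φ ∧ ∃ n, 1 ≤ n ∧ DoubleMapsTo (ψ ^ n) Z Z}

/-- A periodic point is determined by the first `L` letters of its two coordinates, and the alphabet
is finite. -/
theorem finite_periodicPts (hA : 2 ≤ Fintype.card A) (hpos : IsPositiveAut φ)
    (hprim : IsPrimitiveAut φ) (w : FreeGroup A) :
    (periodicPts φ (innerAut w * φ)).Finite := by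
  obtain ⟨L, -, h⟩ := exists_eq_of_periodic hA hpos hprim w
  refine Set.Finite.of_finite_image
    (f := fun Z (c : Bool) (i : Fin L) => (coord c Z).letter i) (Set.toFinite _) ?_
  rintro Z ⟨hZ, m, hm, hZm⟩ Z' ⟨hZ', n, hn, hZn⟩ hZZ
  refine doubleBoundary_ext fun c => ?_
  refine h c _ _ m n hm hn (isOriented_of_mem_attractingSubshift hpos hZ c)
    (isOriented_of_mem_attractingSubshift hpos hZ' c) (doubleMapsTo_iff.1 hZm c)
    (doubleMapsTo_iff.1 hZn c) fun i hi => ?_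
  exact congrFun (congrFun hZZ c) ⟨i, hi⟩

/-- The periodic points have a common period. -/
theorem exists_common_period (hA : 2 ≤ Fintype.card A) (hpos : IsPositiveAut φ)
    (hprim : IsPrimitiveAut φ) (w : FreeGroup A) :
    ∃ h, 1 ≤ h ∧ ∀ Z ∈ periodicPts φ (innerAut w * φ),
      DoubleMapsTo ((innerAut w * φ) ^ h) Z Z := by
  have hfin := finite_periodicPts hA hpos hprim w
  have hex : ∀ Z : DoubleBoundary A, ∃ n, 1 ≤ n ∧ (Z ∈ periodicPts φ (innerAut w * φ) →
      DoubleMapsTo ((innerAut w * φ) ^ n) Z Z) := by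
    intro Z
    by_cases hZ : Z ∈ periodicPts φ (innerAut w * φ)
    · obtain ⟨-, n, hn, h⟩ := hZ
      exact ⟨n, hn, fun _ => h⟩
    · exact ⟨1, le_rfl, fun h => absurd h hZ⟩
  choose f hf1 hf2 using hex
  refine ⟨∏ Z ∈ hfin.toFinset, f Z, Nat.one_le_iff_ne_zero.2 (Finset.prod_ne_zero_iff.2
    fun Z _ => Nat.one_le_iff_ne_zero.1 (hf1 Z)), fun Z hZ => ?_⟩
  obtain ⟨t, ht⟩ := Finset.dvd_prod_of_mem f (hfin.mem_toFinset.2 hZ)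
  rw [ht, pow_mul]
  exact (hf2 Z hZ).pow t

/-- A point with a constant development `(p, a, s)` is periodic under `i_p ∘ φ`. -/
theorem IsDevelopment.exists_period (hA : 2 ≤ Fintype.card A) (hpos : IsPositiveAut φ)
    (hprim : IsPrimitiveAut φ) {W : DoubleBoundary A} {p s : FreeGroup A} {a : A}
    (h : IsDevelopment φ W fun _ => (p, a, s)) :
    ∃ n, 1 ≤ n ∧ DoubleMapsTo ((innerAut p * φ) ^ n) W W := by
  have hedge := h.isEdge
  obtain ⟨w, rfl, hw⟩ := h
  have hor : ∀ i, IsOriented (w i) := fun i => isOriented_of_mem_attractingSubshift hpos (hw i).1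
  -- The image of the point `w (i + 1)` begins with φ(a) = p * a * s in its second coordinate, so
  -- S^{|p|} removes exactly p.
  have h1 : ∀ i, DoubleMapsTo (innerAut p * φ) (w (i + 1)) (w i) := by
    intro i
    obtain ⟨-, -, -, Z, hZ, hwZ⟩ := hw i
    have hinit : (coord true (w (i + 1))).initialWord 1 = FreeGroup.of a := by
      have := (hw (i + 1)).2.1
      simp only at this
      simp [Boundary.initialWord, coord, this, FreeGroup.of]
    have hlet : ∀ j < p.toWord.length, p.toWord[j]? = some (Z.1.2.letter j) := by
      intro j hj
      have hword : (φ (FreeGroup.of a)).toWord = p.toWord ++ (a, true) :: s.toWord := hedge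
      have := hZ.2.getElem?_eq hpos (hor (i + 1) true) 1 (i := j) (by
        rw [hinit, FreeGroup.norm, hword, List.length_append]; omega)
      rwa [hinit, hword, List.getElem?_append_left hj] at this
    rw [shift_iterate_eq_translatePoint _ _ hlet, FreeGroup.mk_toWord] at hwZ
    refine doubleMapsTo_iff.2 fun c => ?_
    rw [boundaryMapsTo_innerAut_mul_iff, hwZ, coord_translatePoint, smul_inv_smul]
    exact doubleMapsTo_iff.1 hZ c
  have h2 : ∀ n i c,
      BoundaryMapsTo ((innerAut p * φ) ^ n) (coord c (w (i + n))) (coord c (w i)) := by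
    intro n i c
    induction n with
    | zero => exact .one _
    | succ n ih => rw [pow_succ]; exact ih.comp (doubleMapsTo_iff.1 (h1 (i + n)) c)
  obtain ⟨k, L, hk, -, hL⟩ := exists_letter_eq_of_mapsTo_pow hA hpos hprim p
  let f : ℕ → Bool → Fin L → A × Bool := fun n c i => (coord c (w n)).letter i
  let T := Fintype.card (Bool → Fin L → A × Bool)
  -- Pigeonhole on `T + 1` successive points at depth `k * (N + 1)`, with `T` the number of possible
  -- beginnings of length `L`. Some pair of indices then serves infinitely many N.
  have h3 : ∀ N : ℕ, ∃ cd : Fin (T + 1) × Fin (T + 1), cd.1 < cd.2 ∧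
      f (cd.1 + k * (N + 1)) = f (cd.2 + k * (N + 1)) := by
    intro N
    obtain ⟨c, d, hcd, hf⟩ := Fintype.exists_ne_map_eq_of_card_lt
      (fun c : Fin (T + 1) => f (c + k * (N + 1))) (by simp [T])
    rcases lt_or_gt_of_ne hcd with h | h
    · exact ⟨(c, d), h, hf⟩
    · exact ⟨(d, c), h, hf.symm⟩
  choose cd hcd1 hcd2 using h3
  obtain ⟨⟨c, d⟩, hinf⟩ := Finite.exists_infinite_fiber cd
  rw [Set.infinite_coe_iff] at hinf
  have hlt : c < d := by
    obtain ⟨N, hN⟩ := hinf.nonempty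
    have := hcd1 N
    rwa [show cd N = (c, d) from hN] at this
  -- For arbitrarily large N these two points are images, under the power `k * (N + 1)`, of points
  -- with a common beginning; expansion makes them agree everywhere.
  have h4 : w c = w d := by
    refine doubleBoundary_ext fun e => ?_
    ext1
    funext i
    obtain ⟨N, hN, hiN⟩ := hinf.exists_gt i
    have hf := hcd2 N
    rw [show cd N = (c, d) from hN] at hf
    refine hL e _ _ _ _ (hor _ e) (hor _ e) (fun j hj => ?_) N (h2 (k * (N + 1)) c e)
      (h2 (k * (N + 1)) d e) i (by omega)
    exact congrFun (congrFun hf e) ⟨j, hj⟩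
  have hlt' : (c : ℕ) < d := hlt
  -- Both are the image of the same point under the power `c`.
  have h5 : w 0 = w (d - c) := by
    refine doubleBoundary_ext fun e => ?_
    have e1 := h2 c 0 e
    have e2 := h2 c (d - c) e
    rw [Nat.sub_add_cancel hlt'.le, ← h4] at e2
    rw [zero_add] at e1
    exact e1.unique e2
  refine ⟨d - c, by omega, doubleMapsTo_iff.2 fun e => ?_⟩
  have := h2 (d - c) 0 e
  rwa [zero_add, ← h5] at this

end Coordinates

/-! ### Absence of periodic boundary points -/

section Aperiodicity

/-- The exponent sum. -/
def exponentSum {A : Type*} : FreeGroup A →* Multiplicative ℤ :=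
  FreeGroup.lift fun _ => Multiplicative.ofAdd 1

variable {A : Type*} [DecidableEq A]

theorem HasSign.exponentSum {g : FreeGroup A} (hg : HasSign true g) :
    exponentSum g = Multiplicative.ofAdd (g.norm : ℤ) := by
  have key : ∀ L : List (A × Bool), (∀ x ∈ L, x.2 = true) →
      _root_.exponentSum (FreeGroup.mk L) = Multiplicative.ofAdd (L.length : ℤ) := by
    intro L hL
    induction L with
    | nil => simp [← FreeGroup.one_eq_mk]
    | cons x L ih =>
      obtain ⟨a, b⟩ := x
      obtain rfl : b = true := hL (a, b) (by simp)
      rw [mk_cons_eq_mul, map_mul, ih fun y hy => hL y (List.mem_cons_of_mem _ hy),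
        List.length_cons, Nat.cast_add, Nat.cast_one, add_comm, ofAdd_add]
      congr 1
  have := key g.toWord hg
  rwa [FreeGroup.mk_toWord] at this

theorem Boundary.initialWord_succ {A : Type*} (X : Boundary A) (n : ℕ) :
    X.initialWord (n + 1) = FreeGroup.mk [X.letter 0] * X.tail.initialWord n := by
  rw [initialWord, initialWord, List.range_succ_eq_map, List.map_cons, mk_cons_eq_mul, List.map_map]
  rfl

/-- Only finitely many letters of X take part in cancellation with g; beyond them the beginnings of
X and gX differ by an index shift. -/
theorem exists_mul_initialWord (g : FreeGroup A) (X : Boundary A) :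
    ∃ m m', ∀ k, g * X.initialWord (m + k) = (g • X).initialWord (m' + k) := by
  have key : ∀ L : List (A × Bool), ∃ m m', ∀ k,
      FreeGroup.mk L * X.initialWord (m + k) = (FreeGroup.mk L • X).initialWord (m' + k) := by
    intro L
    induction L with
    | nil => exact ⟨0, 0, fun k => by simp [← FreeGroup.one_eq_mk]⟩
    | cons x L ih =>
      obtain ⟨m, m', h⟩ := ih
      rw [mk_cons_eq_mul, mul_smul, Boundary.mk_singleton_smul]
      by_cases hx : (FreeGroup.mk L • X).letter 0 = letterInv x
      · refine ⟨m + 1, m', fun k => ?_⟩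
        rw [Boundary.letterMul, dif_pos hx, mul_assoc, add_assoc, add_comm 1 k, h,
          ← add_assoc, Boundary.initialWord_succ, hx, mk_letterInv, mul_inv_cancel_left]
      · refine ⟨m, m' + 1, fun k => ?_⟩
        rw [Boundary.letterMul, dif_neg hx, mul_assoc, h, add_right_comm, Boundary.initialWord_succ]
        rfl
  have := key g.toWord
  rwa [FreeGroup.mk_toWord] at this

/-- An element which fixes a positive boundary point and has exponent sum `d ≥ 0` is conjugate to a
positive word of length `d`. -/
theorem exists_conj_of_smul_eq {X : Boundary A} (hX : X.HasSign true) {g : FreeGroup A}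
    (hg : g • X = X) {d : ℕ} (hd : exponentSum g = Multiplicative.ofAdd (d : ℤ)) :
    ∃ c u : FreeGroup A, HasSign true u ∧ u.norm = d ∧ g = c * u * c⁻¹ := by
  obtain ⟨m, m', h⟩ := exists_mul_initialWord g X
  have h0 := h 0
  rw [hg, add_zero, add_zero] at h0
  have hn : ∀ n, (X.initialWord n).norm = n := fun n => by
    rw [FreeGroup.norm, X.toWord_initialWord]; simp
  have hs : ∀ n, exponentSum (X.initialWord n) = Multiplicative.ofAdd (n : ℤ) := fun n => by
    rw [(hX.initialWord n).exponentSum, hn]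
  have hm : m' = m + d := by
    have := congrArg exponentSum h0
    rw [map_mul, hs, hs, hd, ← ofAdd_add] at this
    have := Multiplicative.ofAdd.injective this
    omega
  rw [hm, X.initialWord_add] at h0
  refine ⟨X.initialWord m, _, ?_, ?_, eq_mul_inv_of_mul_eq h0⟩
  · refine hasSign_mk (b := true) fun x hx => ?_
    obtain ⟨i, -, rfl⟩ := List.mem_map.1 hx
    exact hX _
  · rw [FreeGroup.norm, toWord_mk_of_sign (b := true)]
    · simp
    · intro x hx
      obtain ⟨i, -, rfl⟩ := List.mem_map.1 hx
      exact hX _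

/-- Such an element is conjugate to a word of length 0. Consequently the exponent sum embeds the
stabilizer of X in ℤ. -/
theorem eq_one_of_smul_eq {X : Boundary A} (hX : X.HasSign true) {g : FreeGroup A}
    (hg : g • X = X) (hd : exponentSum g = 1) : g = 1 := by
  obtain ⟨c, u, -, hu, rfl⟩ := exists_conj_of_smul_eq hX hg (d := 0) (by simpa using hd)
  rw [FreeGroup.norm_eq_zero] at hu
  simp [hu]

/-- An automorphism of a free group which sends an element of positive exponent sum to its `e`-th
power has `e ≤ 1`. -/
theorem le_one_of_map_eq_pow {A : Type*} (ψ : MulAut (FreeGroup A)) {g : FreeGroup A} {d e : ℕ}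
    (hd : 1 ≤ d) (hg : exponentSum g = Multiplicative.ofAdd (d : ℤ)) (he : ψ g = g ^ e) :
    e ≤ 1 := by
  by_contra! h
  have h1 : ∀ j : ℕ, (ψ ^ j) g = g ^ e ^ j := by
    intro j
    induction j with
    | zero => simp
    | succ j ih => rw [pow_succ', MulAut.mul_apply, ih, map_pow, he, ← pow_mul, ← pow_succ']
  -- Applying ψ⁻ᵈ makes g an eᵈ-th power, so eᵈ divides its exponent sum d; but eᵈ > d when e ≥ 2.
  have h2 : ((ψ ^ d)⁻¹ g) ^ e ^ d = g := by
    apply (ψ ^ d).injective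
    rw [map_pow, MulAut.apply_inv_self, h1]
  have h3 := congrArg exponentSum h2
  rw [map_pow, hg] at h3
  have h4 : ((e ^ d : ℕ) : ℤ) * Multiplicative.toAdd (exponentSum ((ψ ^ d)⁻¹ g)) = d := by
    have := congrArg Multiplicative.toAdd h3
    simpa using this
  have h5 : e ^ d ∣ d := by
    rw [← Int.natCast_dvd_natCast]
    exact ⟨_, h4.symm⟩
  exact absurd (Nat.le_of_dvd hd h5) (not_le.2 (Nat.lt_pow_self h))

variable [Fintype A]

theorem two_mul_norm_le (hA : 2 ≤ Fintype.card A) {φ : MulAut (FreeGroup A)}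
    (hpos : IsPositiveAut φ) (hprim : IsPrimitiveAut φ) :
    ∃ k, 1 ≤ k ∧ ∀ n, 1 ≤ n → ∀ u, HasSign true u → 2 * u.norm ≤ ((φ ^ (n * k)) u).norm := by
  obtain ⟨k, hk, hall⟩ := hprim
  -- For φᵏ the total length after one step is at least 2, and a second application gives every
  -- letter an image at least that long.
  refine ⟨k * 2, by omega, fun n hn u hu => ?_⟩
  obtain ⟨n, rfl⟩ := Nat.exists_eq_add_of_le' hn
  have h1 := hu.norm_mul_totalLength_le (hpos.pow k) hall 1
  have h2 := Nat.mul_le_mul_left u.norm (lt_totalLength hA (hpos.pow k) hall 1)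
  rw [one_add_one_eq_two, ← pow_mul] at h1
  have h3 := (hu.map (hpos.pow (k * 2))).norm_le_norm_map (hpos.pow (n * (k * 2)))
  rw [← MulAut.mul_apply, ← pow_add] at h3
  rw [add_mul, one_mul]
  omega

/-- A positive boundary point which is fixed by `i_w ∘ φⁿ` has a trivial stabilizer. -/
theorem eq_one_of_smul_eq_of_mapsTo (hA : 2 ≤ Fintype.card A) {φ : MulAut (FreeGroup A)}
    (hpos : IsPositiveAut φ) (hprim : IsPrimitiveAut φ) {X : Boundary A} (hX : X.HasSign true)
    {w : FreeGroup A} {n : ℕ} (hn : 1 ≤ n) (hψ : BoundaryMapsTo (innerAut w * φ ^ n) X X)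
    {g : FreeGroup A} (hg : g • X = X) : g = 1 := by
  classical
  by_contra hne
  have hex : ∃ d : ℕ, 1 ≤ d ∧ ∃ g : FreeGroup A, g • X = X ∧
      exponentSum g = Multiplicative.ofAdd (d : ℤ) := by
    have h0 : Multiplicative.toAdd (exponentSum g) ≠ 0 := fun h =>
      hne (eq_one_of_smul_eq hX hg (Multiplicative.toAdd.injective h))
    rcases lt_or_gt_of_ne h0 with h | h
    · refine ⟨(-Multiplicative.toAdd (exponentSum g)).toNat, by omega, g⁻¹,
        inv_smul_eq_iff.2 hg.symm, ?_⟩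
      rw [map_inv, Int.toNat_of_nonneg (by omega), ofAdd_neg, ofAdd_toAdd]
    · refine ⟨(Multiplicative.toAdd (exponentSum g)).toNat, by omega, g, hg, ?_⟩
      rw [Int.toNat_of_nonneg h.le, ofAdd_toAdd]
  obtain ⟨hd, g₀, hg₀, hs⟩ := Nat.find_spec hex
  have hmin := fun m => Nat.find_min (m := m) hex
  set d := Nat.find hex
  obtain ⟨k, hk, hgrow⟩ := two_mul_norm_le hA hpos hprim
  have hψ' := hψ.pow k
  rw [innerAut_mul_pow, ← pow_mul] at hψ'
  set w' := innerCocycle (φ ^ n) w k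
  set ψ := innerAut w' * φ ^ (n * k) with hψdef
  -- By equivariance, an automorphism whose boundary map fixes X preserves the stabilizer of X.
  have hfix : ψ g₀ • X = X := by
    have := hψ'.smul g₀
    rw [hg₀] at this
    exact this.unique hψ'
  obtain ⟨c, u, hu, hun, hcu⟩ := exists_conj_of_smul_eq hX hg₀ hs
  have hsψ : exponentSum (ψ g₀) =
      Multiplicative.ofAdd ((((φ ^ (n * k)) u).norm : ℕ) : ℤ) := by
    rw [← (hu.map (hpos.pow _)).exponentSum, hcu, hψdef]
    simp [innerAut, mul_comm]
  set e := ((φ ^ (n * k)) u).norm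
  have he : 2 * d ≤ e := hun ▸ hgrow n hn u hu
  -- Euclidean division in the stabilizer: this element has exponent sum `e % d`, which must vanish
  -- by minimality of `d`. Hence ψ(g₀) is a power of g₀ with exponent at least 2, impossible for an
  -- automorphism.
  have hfix' : (ψ g₀ * (g₀ ^ (e / d))⁻¹) • X = X := by
    have : ∀ j : ℕ, g₀ ^ j • X = X := by
      intro j
      induction j with
      | zero => simp
      | succ j ih => rw [pow_succ, mul_smul, hg₀, ih]
    rw [mul_smul, inv_smul_eq_iff.2 (this _).symm, hfix]
  have hmod : exponentSum (ψ g₀ * (g₀ ^ (e / d))⁻¹) = Multiplicative.ofAdd ((e % d : ℕ) : ℤ) := by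
    rw [map_mul, map_inv, map_pow, hsψ, hs, ← ofAdd_nsmul, ← ofAdd_neg, ← ofAdd_add]
    congr 1
    have := Nat.div_add_mod e d
    rw [nsmul_eq_mul]
    nth_rewrite 1 [← this]
    push_cast
    ring
  have hmod0 : e % d = 0 := by
    by_contra h0
    exact hmin (e % d) (Nat.mod_lt _ hd) ⟨by omega, _, hfix', hmod⟩
  have hpow : ψ g₀ = g₀ ^ (e / d) := by
    rw [hmod0] at hmod
    exact mul_inv_eq_one.1 (eq_one_of_smul_eq hX hfix' (by simpa using hmod))
  have h1 := le_one_of_map_eq_pow ψ hd hs hpow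
  have h2 : 2 ≤ e / d := (Nat.le_div_iff_mul_le hd).2 he
  omega

end Aperiodicity

/-! ### The map `γ₊` on words with letters of one sign -/

section Gamma

variable {A : Type*} [DecidableEq A] {φ : MulAut (FreeGroup A)}

/-- Inversion reverses words, so the backward statements for p are forward statements for the
negative word p⁻¹. -/
theorem gammaMinus_eq (φ : MulAut (FreeGroup A)) (u : FreeGroup A) :
    gammaMinus φ u = (gammaPlus φ u⁻¹)⁻¹ := by
  rw [gammaMinus, gammaPlus, mul_inv_rev, ← map_inv, FreeGroup.inv_mk, FreeGroup.inv_mk,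
    FreeGroup.toWord_inv]
  congr 3
  · rcases List.eq_nil_or_concat u.toWord with h | ⟨L, x, h⟩ <;>
      simp [h, FreeGroup.invRev]
  · rcases List.eq_nil_or_concat u.toWord with h | ⟨L, x, h⟩
    · simp [h, FreeGroup.invRev]
    · rw [h, List.concat_eq_append, FreeGroup.invRev_append]
      simp [FreeGroup.invRev, List.map_reverse, Function.comp_def]

theorem gammaMinus_iterate_eq (φ : MulAut (FreeGroup A)) (u : FreeGroup A) (i : ℕ) :
    (gammaMinus φ)^[i] u = ((gammaPlus φ)^[i] u⁻¹)⁻¹ := by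
  induction i with
  | zero => simp
  | succ i ih =>
    rw [Function.iterate_succ_apply', ih, gammaMinus_eq, inv_inv, Function.iterate_succ_apply']

theorem gammaPlus_one (φ : MulAut (FreeGroup A)) : gammaPlus φ 1 = 1 := by
  simp [gammaPlus, ← FreeGroup.one_eq_mk]

theorem gammaPlus_eq_of_cons {v : FreeGroup A} {x : A × Bool} {T : List (A × Bool)}
    (h : v.toWord = x :: T) : gammaPlus φ v = FreeGroup.mk T * φ (FreeGroup.mk [x]) := by
  simp [gammaPlus, h]

/-- γ₊ is a twisted conjugation by the first letter, matching the change of w when a periodic point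
is translated. Knowing that letter, γ₊ can be inverted. -/
theorem gammaPlus_eq_conj {v : FreeGroup A} {x : A × Bool} (h : v.toWord[0]? = some x) :
    gammaPlus φ v = (FreeGroup.mk [x])⁻¹ * v * φ (FreeGroup.mk [x]) := by
  cases hv : v.toWord with
  | nil => simp [hv] at h
  | cons y T =>
    obtain rfl : y = x := by simpa [hv] using h
    rw [gammaPlus_eq_of_cons hv]
    have hv' : v = FreeGroup.mk [y] * FreeGroup.mk T := by
      rw [← mk_cons_eq_mul, ← hv, FreeGroup.mk_toWord]
    rw [hv', inv_mul_cancel_left]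

theorem exists_toWord_eq_cons {v : FreeGroup A} (h : v ≠ 1) : ∃ x T, v.toWord = x :: T :=
  List.exists_cons_of_ne_nil (by rwa [ne_eq, FreeGroup.toWord_eq_nil_iff])

theorem HasSign.gammaPlus (hpos : IsPositiveAut φ) {b : Bool} {v : FreeGroup A}
    (hv : HasSign b v) : HasSign b (gammaPlus φ v) := by
  by_cases h : v = 1
  · rw [h, gammaPlus_one]
    exact .one b
  · obtain ⟨x, T, hx⟩ := exists_toWord_eq_cons h
    have h' : ∀ y ∈ x :: T, y.2 = b := hx ▸ hv
    rw [gammaPlus_eq_of_cons hx]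
    exact (hasSign_mk fun y hy => h' y (List.mem_cons_of_mem _ hy)).mul
      ((hasSign_mk (by simpa using h' x (by simp))).map hpos)

/-- γ₊(v) ends with the whole image of the letter that was removed. -/
theorem HasSign.norm_map_le_norm_gammaPlus (hpos : IsPositiveAut φ) {b : Bool} {v : FreeGroup A}
    (hv : HasSign b v) {x : A × Bool} (hx : v.toWord[0]? = some x) :
    (φ (FreeGroup.of x.1)).norm ≤ (_root_.gammaPlus φ v).norm := by
  cases hvw : v.toWord with
  | nil => simp [hvw] at hx
  | cons y T =>
    obtain rfl : y = x := by simpa [hvw] using hx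
    have h' : ∀ z ∈ y :: T, z.2 = b := hvw ▸ hv
    rw [gammaPlus_eq_of_cons hvw, HasSign.norm_mul (b := b)
      (hasSign_mk fun z hz => h' z (List.mem_cons_of_mem _ hz))
      ((hasSign_mk (by simpa using h' y (by simp))).map hpos), norm_map_letter]
    exact Nat.le_add_left _ _

theorem HasSign.gammaPlus_ne_one (hpos : IsPositiveAut φ) {b : Bool} {v : FreeGroup A}
    (hv : HasSign b v) (h : v ≠ 1) : _root_.gammaPlus φ v ≠ 1 := by
  obtain ⟨x, T, hx⟩ := exists_toWord_eq_cons h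
  have h1 := hv.norm_map_le_norm_gammaPlus hpos (x := x) (by simp [hx])
  have h2 := hpos.one_le_norm x.1
  rw [ne_eq, ← FreeGroup.norm_eq_zero]
  omega

theorem HasSign.gammaPlus_iterate (hpos : IsPositiveAut φ) {b : Bool} {v : FreeGroup A}
    (hv : HasSign b v) (i : ℕ) : HasSign b ((_root_.gammaPlus φ)^[i] v) := by
  induction i with
  | zero => exact hv
  | succ i ih => rw [Function.iterate_succ_apply']; exact ih.gammaPlus hpos

theorem HasSign.gammaPlus_iterate_ne_one (hpos : IsPositiveAut φ) {b : Bool} {v : FreeGroup A}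
    (hv : HasSign b v) (h : v ≠ 1) (i : ℕ) : (_root_.gammaPlus φ)^[i] v ≠ 1 := by
  induction i with
  | zero => exact h
  | succ i ih =>
    rw [Function.iterate_succ_apply']
    exact (hv.gammaPlus_iterate hpos i).gammaPlus_ne_one hpos ih

theorem gammaPlus_iterate_one (φ : MulAut (FreeGroup A)) (i : ℕ) : (gammaPlus φ)^[i] 1 = 1 :=
  Function.iterate_fixed (gammaPlus_one φ) i

theorem eq_of_gammaPlus_eq {u v : FreeGroup A} {x : A × Bool} (hu : u.toWord[0]? = some x)
    (hv : v.toWord[0]? = some x) (h : gammaPlus φ u = gammaPlus φ v) : u = v := by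
  rw [gammaPlus_eq_conj hu, gammaPlus_eq_conj hv] at h
  exact mul_left_cancel (mul_right_cancel h)

/-! ### Points with a constant development -/

theorem IsEdge.hasSign (hpos : IsPositiveAut φ) {p s : FreeGroup A} {a b : A}
    (h : IsEdge φ (p, a, s) b) : HasSign true p ∧ HasSign true s := by
  have h' : (φ (FreeGroup.of b)).toWord = p.toWord ++ (a, true) :: s.toWord := h
  have hs : ∀ x ∈ p.toWord ++ (a, true) :: s.toWord, x.2 = true := h' ▸ (hpos b).2
  exact ⟨fun x hx => hs x (by simp [hx]), fun x hx => hs x (by simp [hx])⟩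

theorem IsEdge.map_eq {p s : FreeGroup A} {a b : A} (h : IsEdge φ (p, a, s) b) :
    φ (FreeGroup.of b) = p * FreeGroup.of a * s := by
  have h' : (φ (FreeGroup.of b)).toWord = p.toWord ++ (a, true) :: s.toWord := h
  rw [← FreeGroup.mk_toWord (x := φ (FreeGroup.of b)), h', mk_append_eq_mul,
    mk_cons_eq_mul _ s.toWord, FreeGroup.mk_toWord, FreeGroup.mk_toWord, ← mul_assoc]
  rfl

theorem IsEdge.norm_lt {p s : FreeGroup A} {a b : A} (h : IsEdge φ (p, a, s) b) :
    p.norm < (φ (FreeGroup.of b)).norm ∧ s.norm < (φ (FreeGroup.of b)).norm := by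
  have h' : (φ (FreeGroup.of b)).toWord = p.toWord ++ (a, true) :: s.toWord := h
  simp only [FreeGroup.norm, h', List.length_append, List.length_cons]
  omega

theorem IsDevelopment.step_letter_zero {W : DoubleBoundary A} {p s : FreeGroup A}
    {a : A} (hpos : IsPositiveAut φ) (hW : W ∈ attractingSubshift φ)
    (h : IsDevelopment φ W fun _ => (p, a, s)) :
    (coord false (step true W)).letter 0 = (a, false) := by
  have := (isOriented_of_mem_attractingSubshift hpos hW).coord_step_not_zero true
  rwa [h.letter_zero] at this

end Gamma

/-! ### Singularities -/

section Singularities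

variable {A : Type*} [DecidableEq A] [Fintype A] {φ : MulAut (FreeGroup A)}

/-- The translate of a periodic point of `i_w ∘ φ` is a periodic point of a conjugate. -/
theorem DoubleMapsTo.translatePoint {w : FreeGroup A} {h : ℕ} {Z : DoubleBoundary A}
    (hZ : DoubleMapsTo ((innerAut w * φ) ^ h) Z Z) (g : FreeGroup A) :
    DoubleMapsTo ((innerAut (φ g * w * g⁻¹) * φ) ^ h) (translatePoint g Z)
      (translatePoint g Z) := by
  have h2 : (innerAut g⁻¹)⁻¹ = innerAut g := by simp [innerAut]
  have h1 : innerAut (φ g * w * g⁻¹) * φ = innerAut g⁻¹ * (innerAut w * φ) * (innerAut g⁻¹)⁻¹ := by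
    rw [h2, mul_assoc (innerAut g⁻¹), mul_assoc (innerAut w), mul_innerAut φ g,
      ← mul_assoc (innerAut w), innerAut_mul_innerAut, ← mul_assoc, innerAut_mul_innerAut]
  rw [h1, conj_pow, h2]
  refine doubleMapsTo_iff.2 fun c => ?_
  have e1 := BoundaryMapsTo.innerAut g (g • coord c Z)
  have e2 := BoundaryMapsTo.innerAut g⁻¹ (coord c Z)
  rw [inv_smul_smul] at e1
  rw [inv_inv] at e2
  rw [coord_translatePoint]
  exact (e2.comp (doubleMapsTo_iff.1 hZ c)).comp e1

/-- A fixed point of a power of `X ↦ v φ(X)` begins with `v`. -/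
theorem toWord_getElem?_zero_of_mapsTo (hpos : IsPositiveAut φ) {b : Bool} {v : FreeGroup A}
    (hv : HasSign b v) (hv1 : v ≠ 1) {X : Boundary A} (hX : X.HasSign b) {h : ℕ} (hh : 1 ≤ h)
    (hXX : BoundaryMapsTo ((innerAut v⁻¹ * φ) ^ h) X X) :
    v.toWord[0]? = some (X.letter 0) := by
  obtain ⟨h, rfl⟩ := Nat.exists_eq_add_of_le' hh
  rw [innerAut_mul_pow, boundaryMapsTo_innerAut_mul_iff] at hXX
  -- The inverse of this cocycle is v times a word of the same sign, so X is a limit of words that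
  -- begin with v.
  have h1 := ConvergesTo.smul hXX (innerCocycle φ v⁻¹ (h + 1))⁻¹
  rw [inv_smul_smul, innerCocycle_succ', mul_inv_rev, inv_inv] at h1
  obtain ⟨n, hn⟩ := (h1 1).exists
  have hs : HasSign b (φ (innerCocycle φ v⁻¹ h))⁻¹ := by
    have := ((hv.inv.innerCocycle hpos h).map hpos).inv
    rwa [Bool.not_not] at this
  have hn0 := hn 0 one_pos
  simp only at hn0
  rw [← hn0, mul_assoc, hv.toWord_mul (hs.mul ((hX.initialWord n).map (hpos.pow _))),
    List.getElem?_append_left]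
  exact List.length_pos_iff.2 (by rwa [ne_eq, FreeGroup.toWord_eq_nil_iff])

theorem toWord_getElem?_zero_of_mem_periodicPts (hpos : IsPositiveAut φ) {b : Bool}
    {v : FreeGroup A} (hv : HasSign b v) (hv1 : v ≠ 1) {Z : DoubleBoundary A}
    (hZ : Z ∈ periodicPts φ (innerAut v⁻¹ * φ)) :
    v.toWord[0]? = some ((coord b Z).letter 0) := by
  obtain ⟨hZm, h, hh, hZZ⟩ := hZ
  exact toWord_getElem?_zero_of_mapsTo hpos hv hv1
    (isOriented_of_mem_attractingSubshift hpos hZm b) hh (doubleMapsTo_iff.1 hZZ b)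

theorem step_mem_periodicPts (hpos : IsPositiveAut φ) {b : Bool} {v : FreeGroup A}
    (hv : HasSign b v) (hv1 : v ≠ 1) {Z : DoubleBoundary A}
    (hZ : Z ∈ periodicPts φ (innerAut v⁻¹ * φ)) :
    step b Z ∈ periodicPts φ (innerAut (gammaPlus φ v)⁻¹ * φ) := by
  have hx := toWord_getElem?_zero_of_mem_periodicPts hpos hv hv1 hZ
  obtain ⟨hZm, h, hh, hZZ⟩ := hZ
  refine ⟨step_mem_attractingSubshift hpos hZm b, h, hh, ?_⟩
  have := hZZ.translatePoint (FreeGroup.mk [(coord b Z).letter 0])⁻¹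
  rw [gammaPlus_eq_conj hx]
  rw [map_inv, inv_inv] at this
  rw [mul_inv_rev, mul_inv_rev, inv_inv, ← mul_assoc]
  exact this

/-- For v = ε no step is allowed: γ₊ fixes ε, whereas translation by x⁻¹ would twist ε into x⁻¹
φ(x). -/
theorem step_iterate_mem_periodicPts (hpos : IsPositiveAut φ) {b : Bool} {v : FreeGroup A}
    (hv : HasSign b v) {Z : DoubleBoundary A} (hZ : Z ∈ periodicPts φ (innerAut v⁻¹ * φ)) {i : ℕ}
    (hi : v = 1 → i = 0) :
    (step b)^[i] Z ∈ periodicPts φ (innerAut ((gammaPlus φ)^[i] v)⁻¹ * φ) := by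
  by_cases hv1 : v = 1
  · rw [hi hv1]
    exact hZ
  · induction i with
    | zero => exact hZ
    | succ i ih =>
      rw [Function.iterate_succ_apply', Function.iterate_succ_apply']
      exact step_mem_periodicPts hpos (hv.gammaPlus_iterate hpos i)
        (hv.gammaPlus_iterate_ne_one hpos hv1 i) (ih fun h => absurd h hv1)

/-- A positive boundary point is fixed by at most one of the maps `i_c ∘ φⁿ`. -/
theorem eq_of_mapsTo_innerAut_mul_pow (hA : 2 ≤ Fintype.card A) (hpos : IsPositiveAut φ)
    (hprim : IsPrimitiveAut φ) {X : Boundary A} (hX : X.HasSign true) {c c' : FreeGroup A} {n : ℕ}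
    (hn : 1 ≤ n) (h : BoundaryMapsTo (innerAut c * φ ^ n) X X)
    (h' : BoundaryMapsTo (innerAut c' * φ ^ n) X X) : c = c' := by
  have h1 := (boundaryMapsTo_innerAut_mul_iff.1 h).unique (boundaryMapsTo_innerAut_mul_iff.1 h')
  refine inv_mul_eq_one.1 (eq_one_of_smul_eq_of_mapsTo hA hpos hprim hX hn h ?_)
  rw [mul_smul, ← h1, inv_smul_smul]

/-- Points of a common singularity are periodic under the same `i_w ∘ φ`. -/
theorem eq_of_mem_singularity (hA : 2 ≤ Fintype.card A) (hpos : IsPositiveAut φ)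
    (hprim : IsPrimitiveAut φ) {b : Bool} {u v : FreeGroup A} (hu : HasSign b u)
    (hv : HasSign b v) {Z Z' : DoubleBoundary A} (hZ : Z ∈ periodicPts φ (innerAut u⁻¹ * φ))
    (hZ' : Z' ∈ periodicPts φ (innerAut v⁻¹ * φ)) {Ω : Set (DoubleBoundary A)}
    (hΩ : IsSingularity φ Ω) (hZΩ : Z ∈ Ω) (hZΩ' : Z' ∈ Ω) : u = v := by
  obtain ⟨ψ, ⟨w, k, hk, rfl⟩, -, -, hfix, -, -⟩ := hΩ
  obtain ⟨hZm, h, hh, hZZ⟩ := hZ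
  obtain ⟨hZm', h', hh', hZZ'⟩ := hZ'
  -- The exponent `k * (h * h')` is common to both periods and to the automorphism fixing Ω;
  -- uniqueness of the inner factor then equates both cocycles with that of `w`.
  have key : ∀ (Y : DoubleBoundary A) (y : FreeGroup A) (m t : ℕ), Y ∈ attractingSubshift φ →
      DoubleMapsTo ((innerAut y⁻¹ * φ) ^ m) Y Y → m * t = k * (h * h') → Y ∈ Ω →
      innerCocycle φ y⁻¹ (k * (h * h')) = innerCocycle (φ ^ k) w (h * h') := by
    intro Y y m t hY hYY hmt hYΩ
    have e1 := (hYY.pow t).2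
    have e2 := ((hfix Y hYΩ).pow (h * h')).2
    rw [← pow_mul, hmt, innerAut_mul_pow] at e1
    rw [innerAut_mul_pow, ← pow_mul] at e2
    exact eq_of_mapsTo_innerAut_mul_pow hA hpos hprim
      (isOriented_of_mem_attractingSubshift hpos hY true) (Nat.mul_pos hk (Nat.mul_pos hh hh'))
      e1 e2
  have e := (key Z u h (k * h') hZm hZZ (by ring) hZΩ).trans
    (key Z' v h' (k * h) hZm' hZZ' (by ring) hZΩ').symm
  exact inv_injective (innerCocycle_injective hpos hu.inv hv.inv
    (Nat.mul_pos hk (Nat.mul_pos hh hh')).ne' e)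

/-- Periodic points of `i_w ∘ φ` which have different first letters belong to a singularity. -/
theorem exists_fixesSingularity (hA : 2 ≤ Fintype.card A) (hpos : IsPositiveAut φ)
    (hprim : IsPrimitiveAut φ) {w : FreeGroup A} {Z Z' : DoubleBoundary A}
    (hZ : Z ∈ periodicPts φ (innerAut w * φ)) (hZ' : Z' ∈ periodicPts φ (innerAut w * φ))
    {c : Bool} (hne : (coord c Z).letter 0 ≠ (coord c Z').letter 0) :
    ∃ h, 1 ≤ h ∧ FixesSingularity φ ((innerAut w * φ) ^ h) (periodicPts φ (innerAut w * φ)) := by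
  obtain ⟨h, hh, hfix⟩ := exists_common_period hA hpos hprim w
  refine ⟨h, hh, ⟨_, h, hh, innerAut_mul_pow φ w h⟩, fun Y hY => hY.1, ⟨Z, hZ, Z', hZ', ?_⟩, hfix,
    fun m hm Y hY hYY => ⟨hY, h * m, Nat.mul_pos hh hm, by rwa [pow_mul]⟩, Z, hZ, Z', hZ', ?_⟩
  · rintro rfl
    exact hne rfl
  · cases c
    · exact Or.inr hne
    · exact Or.inl hne

/-- This is where the bound `L = 1` for the trivial inner factor matters. -/
theorem exists_letter_ne_of_mem_periodicPts (hA : 2 ≤ Fintype.card A) (hpos : IsPositiveAut φ)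
    (hprim : IsPrimitiveAut φ) {Z Z' : DoubleBoundary A}
    (hZ : Z ∈ periodicPts φ (innerAut 1 * φ)) (hZ' : Z' ∈ periodicPts φ (innerAut 1 * φ))
    (hne : Z ≠ Z') : ∃ c, (coord c Z).letter 0 ≠ (coord c Z').letter 0 := by
  by_contra! h
  obtain ⟨L, hL, h1⟩ := exists_eq_of_periodic hA hpos hprim 1
  obtain ⟨hZm, m, hm, hZZ⟩ := hZ
  obtain ⟨hZm', n, hn, hZZ'⟩ := hZ'
  refine hne (doubleBoundary_ext fun c => h1 c _ _ m n hm hn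
    (isOriented_of_mem_attractingSubshift hpos hZm c)
    (isOriented_of_mem_attractingSubshift hpos hZm' c) (doubleMapsTo_iff.1 hZZ c)
    (doubleMapsTo_iff.1 hZZ' c) fun i hi => ?_)
  rw [hL rfl, Nat.lt_one_iff] at hi
  rw [hi]
  exact h c

/-- The first letter of the opposite coordinate after a step. -/
theorem coord_not_step_iterate_succ (hpos : IsPositiveAut φ) {b : Bool} {v : FreeGroup A}
    (hv : HasSign b v) (hv1 : v ≠ 1) {Z : DoubleBoundary A}
    (hZ : Z ∈ periodicPts φ (innerAut v⁻¹ * φ)) (i : ℕ) :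
    ((gammaPlus φ)^[i] v).toWord[0]? =
      some (letterInv ((coord (!b) ((step b)^[i + 1] Z)).letter 0)) := by
  have hi := step_iterate_mem_periodicPts hpos hv hZ (i := i) fun h => absurd h hv1
  rw [toWord_getElem?_zero_of_mem_periodicPts hpos (hv.gammaPlus_iterate hpos i)
    (hv.gammaPlus_iterate_ne_one hpos hv1 i) hi, Function.iterate_succ_apply',
    (isOriented_of_mem_attractingSubshift hpos hi.1).coord_step_not_zero, letterInv_letterInv]

/-- The points obtained from the smallest solution of `γ₊ⁱ(v) = γ₊ʲ(v')` have different first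
letters. -/
theorem exists_letter_ne_of_isLeast (hA : 2 ≤ Fintype.card A) (hpos : IsPositiveAut φ)
    (hprim : IsPrimitiveAut φ) {b : Bool} {v v' : FreeGroup A} (hv : HasSign b v)
    (hv' : HasSign b v') {Z Z' : DoubleBoundary A} (hZ : Z ∈ periodicPts φ (innerAut v⁻¹ * φ))
    (hZ' : Z' ∈ periodicPts φ (innerAut v'⁻¹ * φ)) (hne : Z ≠ Z') {a a' : A}
    (ha : (coord (!b) Z).letter 0 = (a, !b)) (ha' : (coord (!b) Z').letter 0 = (a', !b))
    (hlt : v.norm < (φ (FreeGroup.of a)).norm) (hlt' : v'.norm < (φ (FreeGroup.of a')).norm)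
    (heq : a = a' → v = v' → v = 1) {i j : ℕ}
    (hij : IsLeast {x : ℕ × ℕ | (gammaPlus φ)^[x.1] v = (gammaPlus φ)^[x.2] v'} (i, j)) :
    (v = 1 → i = 0) ∧ (v' = 1 → j = 0) ∧
    ∃ c, (coord c ((step b)^[i] Z)).letter 0 ≠ (coord c ((step b)^[j] Z')).letter 0 := by
  have hmem : (gammaPlus φ)^[i] v = (gammaPlus φ)^[j] v' := hij.1
  have hone : v = 1 ↔ v' = 1 := by
    constructor
    · rintro rfl
      by_contra h
      rw [gammaPlus_iterate_one] at hmem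
      exact hv'.gammaPlus_iterate_ne_one hpos h j hmem.symm
    · rintro rfl
      by_contra h
      rw [gammaPlus_iterate_one] at hmem
      exact hv.gammaPlus_iterate_ne_one hpos h i hmem
  by_cases hv1 : v = 1
  · have hv1' := hone.1 hv1
    have h0 : (i, j) ≤ ((0, 0) : ℕ × ℕ) := hij.2 (by simp [hv1, hv1'])
    obtain ⟨hi, hj⟩ := Prod.mk_le_mk.1 h0
    obtain rfl : i = 0 := by omega
    obtain rfl : j = 0 := by omega
    rw [hv1, inv_one] at hZ
    rw [hv1', inv_one] at hZ'
    exact ⟨fun _ => rfl, fun _ => rfl,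
      exists_letter_ne_of_mem_periodicPts hA hpos hprim hZ hZ' hne⟩
  have hv1' := fun h => hv1 (hone.2 h)
  refine ⟨fun h => absurd h hv1, fun h => absurd h hv1', !b, fun hc => ?_⟩
  have hZi := coord_not_step_iterate_succ hpos hv hv1 hZ
  have hZj := coord_not_step_iterate_succ hpos hv' hv1' hZ'
  cases i with
  | zero =>
    cases j with
    | zero =>
      change (coord (!b) Z).letter 0 = (coord (!b) Z').letter 0 at hc
      rw [ha, ha'] at hc
      exact hv1 (heq (congrArg Prod.fst hc) hmem)
    | succ j =>
      -- By `hc` the last letter removed on the primed side is `a`. The word produced is then at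
      -- least as long as φ(a), yet it equals `v`, which is shorter.
      have h1 := (hv'.gammaPlus_iterate hpos j).norm_map_le_norm_gammaPlus hpos (hZj j)
      rw [← hc, Function.iterate_zero_apply, ha, ← Function.iterate_succ_apply' (gammaPlus φ),
        ← hmem] at h1
      exact absurd hlt (not_lt.2 h1)
  | succ i =>
    cases j with
    | zero =>
      have h1 := (hv.gammaPlus_iterate hpos i).norm_map_le_norm_gammaPlus hpos (hZi i)
      rw [hc, Function.iterate_zero_apply, ha', ← Function.iterate_succ_apply' (gammaPlus φ),
        hmem] at h1
      exact absurd hlt' (not_lt.2 h1)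
    | succ j =>
      -- By `hc` the last letters removed on the two sides coincide, so γ₊ can be undone and a
      -- smaller pair is a solution.
      have h1 : (gammaPlus φ)^[i] v = (gammaPlus φ)^[j] v' := by
        refine eq_of_gammaPlus_eq (φ := φ) (hZi i) (by rw [hZj j, hc]) ?_
        rwa [← Function.iterate_succ_apply' (gammaPlus φ),
          ← Function.iterate_succ_apply' (gammaPlus φ)]
      have h0 : (i + 1, j + 1) ≤ (i, j) := hij.2 h1
      have := (Prod.mk_le_mk.1 h0).1
      omega

theorem exists_singularity_of_isLeast (hA : 2 ≤ Fintype.card A) (hpos : IsPositiveAut φ)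
    (hprim : IsPrimitiveAut φ) {b : Bool} {v v' : FreeGroup A} (hv : HasSign b v)
    (hv' : HasSign b v') {Z Z' : DoubleBoundary A} (hZ : Z ∈ periodicPts φ (innerAut v⁻¹ * φ))
    (hZ' : Z' ∈ periodicPts φ (innerAut v'⁻¹ * φ)) (hne : Z ≠ Z') {a a' : A}
    (ha : (coord (!b) Z).letter 0 = (a, !b)) (ha' : (coord (!b) Z').letter 0 = (a', !b))
    (hlt : v.norm < (φ (FreeGroup.of a)).norm) (hlt' : v'.norm < (φ (FreeGroup.of a')).norm)
    (heq : a = a' → v = v' → v = 1) {i j : ℕ}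
    (hij : IsLeast {x : ℕ × ℕ | (gammaPlus φ)^[x.1] v = (gammaPlus φ)^[x.2] v'} (i, j)) :
    ∃ Ω, IsSingularity φ Ω ∧ (step b)^[i] Z ∈ Ω ∧ (step b)^[j] Z' ∈ Ω ∧
      ∃ (h : ℕ) (w : FreeGroup A), 1 ≤ h ∧ w = ((gammaPlus φ)^[i] v)⁻¹ ∧
        FixesSingularity φ ((innerAut w * φ) ^ h) Ω := by
  obtain ⟨hi, hj, c, hc⟩ :=
    exists_letter_ne_of_isLeast hA hpos hprim hv hv' hZ hZ' hne ha ha' hlt hlt' heq hij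
  have h1 := step_iterate_mem_periodicPts hpos hv hZ hi
  have h2 := step_iterate_mem_periodicPts hpos hv' hZ' hj
  rw [← show (gammaPlus φ)^[i] v = (gammaPlus φ)^[j] v' from hij.1] at h2
  obtain ⟨h, hh, hfix⟩ := exists_fixesSingularity hA hpos hprim h1 h2 hc
  exact ⟨_, ⟨_, hfix⟩, h1, h2, h, _, hh, rfl, hfix⟩

theorem not_exists_singularity (hA : 2 ≤ Fintype.card A) (hpos : IsPositiveAut φ)
    (hprim : IsPrimitiveAut φ) {b : Bool} {v v' : FreeGroup A} (hv : HasSign b v)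
    (hv' : HasSign b v') {Z Z' : DoubleBoundary A} (hZ : Z ∈ periodicPts φ (innerAut v⁻¹ * φ))
    (hZ' : Z' ∈ periodicPts φ (innerAut v'⁻¹ * φ))
    (hne : ∀ i j : ℕ, (gammaPlus φ)^[i] v ≠ (gammaPlus φ)^[j] v') {i j : ℕ} (hi : v = 1 → i = 0)
    (hj : v' = 1 → j = 0) :
    ¬ ∃ Ω, IsSingularity φ Ω ∧ (step b)^[i] Z ∈ Ω ∧ (step b)^[j] Z' ∈ Ω := by
  rintro ⟨Ω, hΩ, h1, h2⟩
  exact hne i j (eq_of_mem_singularity hA hpos hprim (hv.gammaPlus_iterate hpos i)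
    (hv'.gammaPlus_iterate hpos j) (step_iterate_mem_periodicPts hpos hv hZ hi)
    (step_iterate_mem_periodicPts hpos hv' hZ' hj) hΩ h1 h2)

/-! ### Periodicity of the points with a constant development -/

variable {W : DoubleBoundary A} {p s : FreeGroup A} {a : A}

theorem IsDevelopment.mem_periodicPts (hA : 2 ≤ Fintype.card A) (hpos : IsPositiveAut φ)
    (hprim : IsPrimitiveAut φ) (hW : W ∈ attractingSubshift φ)
    (h : IsDevelopment φ W fun _ => (p, a, s)) :
    W ∈ periodicPts φ (innerAut (p⁻¹)⁻¹ * φ) := by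
  rw [inv_inv]
  exact ⟨hW, h.exists_period hA hpos hprim⟩

/-- Translation by a⁻¹ changes p into φ(a)⁻¹ p a, which is s⁻¹ because φ(a) = p a s. -/
theorem IsDevelopment.step_mem_periodicPts (hA : 2 ≤ Fintype.card A) (hpos : IsPositiveAut φ)
    (hprim : IsPrimitiveAut φ) (hW : W ∈ attractingSubshift φ)
    (h : IsDevelopment φ W fun _ => (p, a, s)) :
    step true W ∈ periodicPts φ (innerAut s⁻¹ * φ) := by
  obtain ⟨n, hn, hWW⟩ := h.exists_period hA hpos hprim
  refine ⟨step_mem_attractingSubshift hpos hW true, n, hn, ?_⟩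
  have h1 := hWW.translatePoint (FreeGroup.of a)⁻¹
  have h2 : φ (FreeGroup.of a)⁻¹ * p * (FreeGroup.of a)⁻¹⁻¹ = s⁻¹ := by
    rw [map_inv, h.isEdge.map_eq]
    group
  rw [h2] at h1
  rw [step, h.letter_zero]
  exact h1

end Singularities

theorem mainTheorem8 {A : Type*} [Fintype A] [DecidableEq A] (hA : 2 ≤ Fintype.card A)
    (φ : MulAut (FreeGroup A)) (hpos : IsPositiveAut φ) (hprim : IsPrimitiveAut φ)
    (W W' : DoubleBoundary A)
    (hWmem : W ∈ attractingSubshift φ) (hWmem' : W' ∈ attractingSubshift φ) (hne : W ≠ W')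
    (p s q r : FreeGroup A) (a b : A)
    (hW : IsDevelopment φ W (fun _ => (p, a, s)))
    (hW' : IsDevelopment φ W' (fun _ => (q, b, r))) :
    -- (1), backward and forward
    ((∀ i j : ℕ, (gammaMinus φ)^[i] p ≠ (gammaMinus φ)^[j] q) →
      ∀ i j : ℕ, (p = 1 → i = 0) → (q = 1 → j = 0) →
        ¬ ∃ Ω, IsSingularity φ Ω ∧ shiftPow (-(i : ℤ)) W ∈ Ω ∧ shiftPow (-(j : ℤ)) W' ∈ Ω) ∧
    ((∀ i j : ℕ, (gammaPlus φ)^[i] s ≠ (gammaPlus φ)^[j] r) →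
      ∀ i j : ℕ, (s = 1 → i = 0) → (r = 1 → j = 0) →
        ¬ ∃ Ω, IsSingularity φ Ω ∧
          shiftPow ((i : ℤ) + 1) W ∈ Ω ∧ shiftPow ((j : ℤ) + 1) W' ∈ Ω) ∧
    -- (2), backward and forward
    (((p, a, s) ≠ (q, b, r) ∨ p = 1) →
      ∀ i j : ℕ, IsLeast {x : ℕ × ℕ | (gammaMinus φ)^[x.1] p = (gammaMinus φ)^[x.2] q} (i, j) →
        ∃ Ω, IsSingularity φ Ω ∧
          shiftPow (-(i : ℤ)) W ∈ Ω ∧ shiftPow (-(j : ℤ)) W' ∈ Ω ∧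
          ∃ (h : ℕ) (w : FreeGroup A), 1 ≤ h ∧ w = (gammaMinus φ)^[i] p ∧
            FixesSingularity φ ((innerAut w * φ) ^ h) Ω) ∧
    (((p, a, s) ≠ (q, b, r) ∨ s = 1) →
      ∀ i j : ℕ, IsLeast {x : ℕ × ℕ | (gammaPlus φ)^[x.1] s = (gammaPlus φ)^[x.2] r} (i, j) →
        ∃ Ω, IsSingularity φ Ω ∧
          shiftPow ((i : ℤ) + 1) W ∈ Ω ∧ shiftPow ((j : ℤ) + 1) W' ∈ Ω ∧
          ∃ (h : ℕ) (w : FreeGroup A), 1 ≤ h ∧ w⁻¹ = (gammaPlus φ)^[i] s ∧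
            FixesSingularity φ ((innerAut w * φ) ^ h) Ω) := by
  have hedge := hW.isEdge
  have hedge' := hW'.isEdge
  have hor := isOriented_of_mem_attractingSubshift hpos hWmem
  have hor' := isOriented_of_mem_attractingSubshift hpos hWmem'
  have hp : HasSign false p⁻¹ := (hedge.hasSign hpos).1.inv
  have hq : HasSign false q⁻¹ := (hedge'.hasSign hpos).1.inv
  have hs := (hedge.hasSign hpos).2
  have hr := (hedge'.hasSign hpos).2
  have hZ := hW.mem_periodicPts hA hpos hprim hWmem
  have hZ' := hW'.mem_periodicPts hA hpos hprim hWmem'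
  have hS := hW.step_mem_periodicPts hA hpos hprim hWmem
  have hS' := hW'.step_mem_periodicPts hA hpos hprim hWmem'
  refine ⟨fun h i j hi hj => ?_, fun h i j hi hj => ?_, fun h i j hij => ?_, fun h i j hij => ?_⟩
  · simp only [gammaMinus_iterate_eq, ne_eq, inv_inj] at h
    rw [shiftPow_neg_natCast, shiftPow_neg_natCast]
    exact not_exists_singularity hA hpos hprim hp hq hZ hZ' h (fun h => hi (inv_eq_one.1 h))
      fun h => hj (inv_eq_one.1 h)
  · rw [shiftPow_natCast_add_one, shiftPow_natCast_add_one]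
    exact not_exists_singularity hA hpos hprim hs hr hS hS' h hi hj
  · simp only [gammaMinus_iterate_eq, inv_inj] at hij ⊢
    rw [shiftPow_neg_natCast, shiftPow_neg_natCast]
    refine exists_singularity_of_isLeast hA hpos hprim hp hq hZ hZ' hne hW.letter_zero
      hW'.letter_zero ?_ ?_ ?_ hij
    · rw [FreeGroup.norm_inv_eq]; exact hedge.norm_lt.1
    · rw [FreeGroup.norm_inv_eq]; exact hedge'.norm_lt.1
    -- With equal letters and equal prefixes, cancellation in φ(a) = p a s makes the suffixes equal
    -- too, leaving only p = ε.
    · rintro rfl hpq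
      obtain rfl := inv_injective hpq
      have hsr := hedge.map_eq.symm.trans hedge'.map_eq
      obtain rfl := mul_left_cancel hsr
      rw [h.resolve_left (by simp), inv_one]
  · rw [shiftPow_natCast_add_one, shiftPow_natCast_add_one]
    simp only [inv_eq_iff_eq_inv]
    refine exists_singularity_of_isLeast hA hpos hprim hs hr hS hS' ?_
      (hW.step_letter_zero hpos hWmem) (hW'.step_letter_zero hpos hWmem') hedge.norm_lt.2
      hedge'.norm_lt.2 ?_ hij
    -- The shift is injective on oriented points, so S(W) and S(W') remain distinct.
    · intro heq
      exact hne (hor.shiftInv_shift.symm.trans ((congrArg shiftInv heq).trans hor'.shiftInv_shift))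
    · rintro rfl rfl
      have hpq := hedge.map_eq.symm.trans hedge'.map_eq
      obtain rfl := mul_right_cancel (mul_right_cancel hpq)
      exact h.resolve_left (by simp)
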